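/- Let $x^{\langle p\rangle}:=|x|^p\,\mathrm{sgn}(x)$, let $\alpha_1,\alpha_2\in(1,2)$, $\sigma_1,\sigma_2>0$ be known, let $q\in(-1,1)$ and $0<p<\min(\alpha_1,\alpha_2)/4$. Let $S_\alpha(\sigma,\beta,\mu)$ denote the stable law on $\mathbb R$ which for $\alpha\neq1$ has characteristic function $\theta\mapsto\exp\big(-\sigma^\alpha|\theta|^\alpha(1-i\beta\,\mathrm{sgn}(\theta)\tan\frac{\pi\alpha}2)+i\mu\theta\big)$. Let $X=(X_1,X_2)$ with $X_i=A_i^{1/2}G_i$, where $A_1,A_2$ are independent, $A_i\sim S_{\alpha_i/2}\big((\cos\frac{\pi\alpha_i}4)^{2/\alpha_i},1,0\big)$, and $G=(G_1,G_2)$ is a Gaussian vector, independent of $(A_1,A_2)$, with mean zero, $\mathbb E[G_i^2]=2\sigma_i^2$ and $\mathbb E[G_1G_2]=2\sigma_1\sigma_2q$. Let $X(1),X(2),\dots$ be independent random vectors with the law of $X$. Put $$C_{\alpha,p}=\frac{2^{p/2}\Gamma(1-p/\alpha)}{p\int_0^\infty u^{-p/2-1}\sin^2u\,du}\Big(1+\tan^2\frac{\alpha\pi}4\Big)^{\frac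 p{2\alpha}}\Big(\cos\frac{\pi\alpha}4\Big)^{\frac p\alpha}\cos\frac{p\pi}4,\qquad g_p(x)=\frac{x_1^{\langle p\rangle}x_2^{\langle p\rangle}}{2^p\sigma_1^p\sigma_2^p\,C_{\alpha_1,p}C_{\alpha_2,p}},$$ and, for $r\in(-1,1)$, $f_p(r)=\mathbb E[(Z_1Z_2)^{\langle p\rangle}]$ with $Z_1,Z_2$ jointly normal, centred, of unit variance and correlation $r$. Then $f_p$ is injective on $(-1,1)$, it is differentiable at $q$ with $f_p'(q)\neq0$, and $\mathbb E[g_p(X)^2]<\infty$. Let $f_p^{\leftarrow}$ be the inverse of $f_p:(-1,1)\to f_p((-1,1))$, extended to $\mathbb R$ by an arbitrary measurable function outside $f_p((-1,1))$, and set $$\hat q_n=f_p^{\leftarrow}\Big(\frac1n\sum_{t=1}^n g_p(X(t))\Big).$$ Then, as $n\to\infty$, $$\sqrt n\,(\hat q_n-q)\Rightarrow N\Big(0,\;f_p'(q)^{-2}\big(\mathbb E[g_p(X)^2]-f_p(q)^2\big)\Big),$$ where $\Rightarrow$ denotes convergence in law. -/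

import Mathlib

open MeasureTheory ProbabilityTheory Filter Topology

noncomputable section

namespace StableLike

/-- The signed power `x^{⟨p⟩} = |x|^p sgn x`. -/
def signedPow (p x : ℝ) : ℝ := |x| ^ p * Real.sign x

/-- The characteristic function of the stable law `S_α(σ, β, μ)`
(Samorodnitsky-Taqqu parametrization). -/
def stableCharFun (α σ β μ θ : ℝ) : ℂ :=
  if α = 1 then
    Complex.exp
      (-((σ * |θ| : ℝ) : ℂ) *
          (1 + Complex.I * ((β * (2 / Real.pi) * Real.sign θ * Real.log |θ| : ℝ) : ℂ))
        + Complex.I * ((μ * θ : ℝ) : ℂ))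
  else
    Complex.exp
      (-((σ ^ α * |θ| ^ α : ℝ) : ℂ) *
          (1 - Complex.I * ((β * Real.sign θ * Real.tan (Real.pi * α / 2) : ℝ) : ℂ))
        + Complex.I * ((μ * θ : ℝ) : ℂ))

/-- `ν` is the stable law `S_α(σ, β, μ)` on the real line. -/
def IsStableLaw (α σ β μ : ℝ) (ν : Measure ℝ) : Prop :=
  IsProbabilityMeasure ν ∧ ∀ θ : ℝ, charFun ν θ = stableCharFun α σ β μ θ

/-- The ingredients of the stable-like model: `A 1, …, A d` are independent positive stable
variables of index `α i / 2`, and `G` is a centred Gaussian vector with covariance matrix `Q`,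
independent of `(A 1, …, A d)`. -/
structure IsModel {d : ℕ} {Ω : Type*} [MeasurableSpace Ω] (P : Measure Ω)
    (α : Fin d → ℝ) (Q : Matrix (Fin d) (Fin d) ℝ)
    (A : Fin d → Ω → ℝ) (G : Ω → EuclideanSpace ℝ (Fin d)) : Prop where
  aemeasurable_A : ∀ i, AEMeasurable (A i) P
  law_A : ∀ i, IsStableLaw (α i / 2) (Real.cos (Real.pi * α i / 4) ^ (2 / α i)) 1 0
    (P.map (A i))
  indep_A : iIndepFun A P
  law_G : HasLaw G (multivariateGaussian 0 Q) P
  indep_A_G : IndepFun (fun ω i => A i ω) G P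

/-- The random vector `X = A^{1/2} G`, where `A = diag(A 1, …, A d)`. -/
def modelVector {d : ℕ} {Ω : Type*} (A : Fin d → Ω → ℝ) (G : Ω → EuclideanSpace ℝ (Fin d))
    (ω : Ω) : Fin d → ℝ :=
  fun i => Real.sqrt (A i ω) * G ω i

/-- The covariance matrix with diagonal entries `2 σ i ^ 2` and correlation `q`. -/
def covMat (σ : Fin 2 → ℝ) (q : ℝ) : Matrix (Fin 2) (Fin 2) ℝ :=
  !![2 * σ 0 ^ 2, 2 * σ 0 * σ 1 * q; 2 * σ 0 * σ 1 * q, 2 * σ 1 ^ 2]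

/-- The constant `C_{α,p}`. -/
def momentConst (α p : ℝ) : ℝ :=
  2 ^ (p / 2) * Real.Gamma (1 - p / α)
      / (p * ∫ u in Set.Ioi (0 : ℝ), u ^ (-p / 2 - 1) * Real.sin u ^ 2)
    * (1 + Real.tan (α * Real.pi / 4) ^ 2) ^ (p / (2 * α))
    * Real.cos (Real.pi * α / 4) ^ (p / α)
    * Real.cos (p * Real.pi / 4)

/-- `f_p(q) = E[(Z₁ Z₂)^{⟨p⟩}]`, where `Z₁, Z₂` are jointly normal, centred, of variance `1`
and correlation `q`. It is used for `q ∈ (-1, 1)` only. -/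
def f (p q : ℝ) : ℝ :=
  ∫ z, signedPow p (z 0 * z 1) ∂(multivariateGaussian 0 !![1, q; q, 1])

/-- The inverse of `f_p : (-1, 1) → ℝ`, extended by `ext` outside the range of `f_p`. -/
def fInv (p : ℝ) (ext : ℝ → ℝ) (y : ℝ) : ℝ :=
  open Classical in
  if y ∈ f p '' Set.Ioo (-1) 1 then Function.invFunOn (f p) (Set.Ioo (-1) 1) y else ext y

/-- The normalized signed product `g_p(x)`; for `σ 0 = σ 1 = 1 / √2` the factor
`2 ^ p * σ 0 ^ p * σ 1 ^ p` equals `1`. -/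
def g (α σ : Fin 2 → ℝ) (p : ℝ) (x : Fin 2 → ℝ) : ℝ :=
  signedPow p (x 0) * signedPow p (x 1)
    / (2 ^ p * σ 0 ^ p * σ 1 ^ p * momentConst (α 0) p * momentConst (α 1) p)

/-- The estimator `f_p^←(n⁻¹ ∑_{t ≤ n} g_p(X(t)))` of the correlation `q`. -/
def qHat (α σ : Fin 2 → ℝ) (p : ℝ) (ext : ℝ → ℝ) {Ω : Type*} (X : ℕ → Ω → Fin 2 → ℝ)
    (n : ℕ) (ω : Ω) : ℝ :=
  fInv p ext ((n : ℝ)⁻¹ * ∑ t ∈ Finset.range n, g α σ p (X t ω))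

end StableLike

end

/-! The estimator is a fixed function of a sample mean of i.i.d. variables `g (X t)`, so its
asymptotic normality is the central limit theorem followed by the delta method
(`tendstoInDistribution_delta`). Three facts make this applicable.

The mean of `g` is `f p q` (`IsModel.integral_g`). Signed powers are multiplicative and the `A i`
and `G` are independent, so the expectation splits into moments of order `p / 2` of the `A i` times
a Gaussian factor, and `momentConst` is exactly that stable moment. The moment is read off the
characteristic function by integrating `1 - charFun` against `u ^ (-s - 1)`: Fubini gives one
equation between complex numbers, whose imaginary part shows that the negative part of the law has
zero moment and whose real part gives the value (`integral_max_rpow_of_charFun`). Square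
integrability holds because `p` is below `α i / 2` and `2 * p ≤ 1`.

`f p` grows at least linearly (`exists_mul_sub_le_f_sub`). In polar coordinates `f p r` is a
positive constant times the integral of `signedPow p (r + cos θ)`, and the signed power has slope
bounded below on `[-2, 2]`. Injectivity, positivity of the derivative and continuity of the inverse
all follow from this one bound.

`f p` is differentiable (`differentiableAt_f`). The polar formula is awkward here, because the
signed power has infinite slope at zero. A change of variables instead moves `r` into the exponent
of the Gaussian density, where one may differentiate under the integral. -/

namespace StableLike

open Set

/-! ### Mellin-type integrals of `1 - exp (-z u)` -/

lemma integrableOn_rpow_mul_min {s b : ℝ} (hs : 0 < s) (hb : s < b) :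
    IntegrableOn (fun u : ℝ => u ^ (-s - 1) * min 1 (u ^ b)) (Ioi 0) := by
  have hmeas : Measurable (fun u : ℝ => u ^ (-s - 1) * min 1 (u ^ b)) := by fun_prop
  rw [← Ioc_union_Ioi_eq_Ioi zero_le_one]
  refine IntegrableOn.union ?_ ?_
  · have h := (intervalIntegral.integrableOn_Ioo_rpow_iff (s := b - s - 1) one_pos).2 (by linarith)
    rw [← integrableOn_Ioc_iff_integrableOn_Ioo] at h
    refine Integrable.mono' h hmeas.aestronglyMeasurable ?_
    filter_upwards [ae_restrict_mem measurableSet_Ioc] with u hu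
    have h0 : 0 < u := hu.1
    rw [Real.norm_of_nonneg (by positivity)]
    calc u ^ (-s - 1) * min 1 (u ^ b) ≤ u ^ (-s - 1) * u ^ b := by
          gcongr; exact min_le_right _ _
      _ = u ^ (b - s - 1) := by rw [← Real.rpow_add h0]; congr 1; ring
  · have h := integrableOn_Ioi_rpow_of_lt (a := -s - 1) (by linarith) one_pos
    refine Integrable.mono' h hmeas.aestronglyMeasurable ?_
    filter_upwards [ae_restrict_mem measurableSet_Ioi] with u hu
    have h0 : 0 < u := zero_lt_one.trans hu
    rw [Real.norm_of_nonneg (by positivity)]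
    exact mul_le_of_le_one_right (by positivity) (min_le_left _ _)

lemma norm_one_sub_exp_neg_le {z : ℂ} (hz : 0 ≤ z.re) :
    ‖1 - Complex.exp (-z)‖ ≤ 2 * min 1 ‖z‖ := by
  have h2 : ‖1 - Complex.exp (-z)‖ ≤ 2 := by
    refine (norm_sub_le _ _).trans ?_
    have : ‖Complex.exp (-z)‖ ≤ 1 := by
      rw [Complex.norm_exp]; simpa using hz
    rw [norm_one]; linarith
  rcases le_total 1 ‖z‖ with h | h
  · rw [min_eq_left h]; linarith
  · rw [min_eq_right h, norm_sub_rev]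
    simpa using Complex.norm_exp_sub_one_le (x := -z) (by simpa using h)

lemma norm_expMellin_integrand_le (s : ℝ) {z : ℂ} (hz : 0 ≤ z.re) {u : ℝ} (hu : 0 < u) :
    ‖((u ^ (-s - 1) : ℝ) : ℂ) * (1 - Complex.exp (-(z * u)))‖
      ≤ 2 * max 1 ‖z‖ * (u ^ (-s - 1) * min 1 (u ^ (1 : ℝ))) := by
  have h0 : 0 < u ^ (-s - 1) := by positivity
  have h1 : 0 ≤ (z * u).re := by simpa using mul_nonneg hz hu.le
  rw [norm_mul, Complex.norm_of_nonneg h0.le, Real.rpow_one]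
  have h2 := norm_one_sub_exp_neg_le h1
  rw [norm_mul, Complex.norm_of_nonneg hu.le] at h2
  have h3 : min 1 (‖z‖ * u) ≤ max 1 ‖z‖ * min 1 u := by
    rw [mul_min_of_nonneg _ _ (by positivity)]
    refine min_le_min (by simp) ?_
    gcongr; exact le_max_right _ _
  calc _ ≤ u ^ (-s - 1) * (2 * (max 1 ‖z‖ * min 1 u)) := by gcongr; linarith
    _ = _ := by ring

/-- The integral `∫₀^∞ u^{-s-1} (1 - e^{-zu}) du`, equal to `Γ(1 - s) z ^ s / s` in the right
half-plane. -/
noncomputable def expMellin (s : ℝ) (z : ℂ) : ℂ :=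
  ∫ u in Ioi (0 : ℝ), ((u ^ (-s - 1) : ℝ) : ℂ) * (1 - Complex.exp (-(z * u)))

lemma integrableOn_expMellin {s : ℝ} (hs : s ∈ Ioo (0 : ℝ) 1) {z : ℂ} (hz : 0 ≤ z.re) :
    IntegrableOn (fun u : ℝ => ((u ^ (-s - 1) : ℝ) : ℂ) * (1 - Complex.exp (-(z * u))))
      (Ioi 0) := by
  refine Integrable.mono' ((integrableOn_rpow_mul_min hs.1 hs.2).const_mul (2 * max 1 ‖z‖))
    (by fun_prop) ?_
  filter_upwards [ae_restrict_mem measurableSet_Ioi] with u hu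
  exact norm_expMellin_integrand_le s hz hu

/-- The closed half-plane matters: characteristic functions live on its boundary, where the formula
is reached only as a limit. -/
lemma continuousWithinAt_expMellin {s : ℝ} (hs : s ∈ Ioo (0 : ℝ) 1) (z : ℂ) :
    ContinuousWithinAt (expMellin s) {z | 0 ≤ z.re} z := by
  refine continuousWithinAt_of_dominated
    (bound := fun u => 2 * max 1 (‖z‖ + 1) * (u ^ (-s - 1) * min 1 (u ^ (1 : ℝ)))) ?_ ?_
    ((integrableOn_rpow_mul_min hs.1 hs.2).const_mul _) ?_
  · exact Eventually.of_forall fun w => by fun_prop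
  · have h1 : ∀ᶠ w in 𝓝[{z | 0 ≤ z.re}] z, ‖w‖ < ‖z‖ + 1 :=
      mem_nhdsWithin_of_mem_nhds
        (continuous_norm.continuousAt.eventually_lt_const (by simp))
    filter_upwards [self_mem_nhdsWithin, h1] with w hw hw1
    filter_upwards [ae_restrict_mem measurableSet_Ioi] with u hu
    refine (norm_expMellin_integrand_le s hw hu).trans ?_
    have : (0 : ℝ) < u := hu
    gcongr
  · exact Eventually.of_forall fun u => by
      apply Continuous.continuousWithinAt; fun_prop

lemma differentiableAt_expMellin {s : ℝ} (hs : s ∈ Ioo (0 : ℝ) 1) {z : ℂ} (hz : 0 < z.re) :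
    DifferentiableAt ℂ (expMellin s) z := by
  -- The differentiated kernel decays only through `exp (-u * re w)`, so `re w` must stay away from
  -- zero to have a uniform majorant.
  have hU : {w : ℂ | z.re / 2 < w.re} ∈ 𝓝 z :=
    (isOpen_lt continuous_const Complex.continuous_re).mem_nhds (by simp [hz])
  have hb := integrableOn_rpow_mul_exp_neg_mul_rpow (p := 1) (s := -s) (b := z.re / 2)
    (by linarith [hs.2]) one_pos (by positivity)
  refine (hasDerivAt_integral_of_dominated_loc_of_deriv_le (μ := volume.restrict (Ioi 0))
    (F := fun w (u : ℝ) => ((u ^ (-s - 1) : ℝ) : ℂ) * (1 - Complex.exp (-(w * u))))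
    (F' := fun w (u : ℝ) => ((u ^ (-s) : ℝ) : ℂ) * Complex.exp (-(w * u))) hU ?_
    (integrableOn_expMellin hs hz.le) ?_ ?_ hb ?_).2.differentiableAt
  · exact Eventually.of_forall fun w => by fun_prop
  · fun_prop
  · filter_upwards [ae_restrict_mem measurableSet_Ioi] with u hu w hw
    have h0 : (0 : ℝ) < u := hu
    rw [norm_mul, Complex.norm_of_nonneg (by positivity), Complex.norm_exp, Real.rpow_one]
    simp only [Complex.neg_re, Complex.re_mul_ofReal, neg_mul]
    have : z.re / 2 < w.re := hw
    gcongr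
  · filter_upwards [ae_restrict_mem measurableSet_Ioi] with u hu w hw
    have h0 : (0 : ℝ) < u := hu
    have h1 : HasDerivAt (fun w : ℂ => -(w * u)) (-(1 * (u : ℂ))) w :=
      ((hasDerivAt_id w).mul_const (u : ℂ)).neg
    have h2 := (h1.cexp.const_sub 1).const_mul ((u ^ (-s - 1) : ℝ) : ℂ)
    refine h2.congr_deriv ?_
    have : u ^ (-s) = u ^ (-s - 1) * u := by
      rw [← Real.rpow_add_one h0.ne']; congr 1; ring
    rw [this]; push_cast; ring

/-- Integration by parts against `-u ^ (-s) / s` leaves the Gamma integral. The boundary term at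
zero vanishes because `1 - exp (-u) ≤ u` and `s < 1`. -/
lemma expMellin_one {s : ℝ} (hs : s ∈ Ioo (0 : ℝ) 1) :
    expMellin s 1 = ((Real.Gamma (1 - s) / s : ℝ) : ℂ) := by
  have hs0 : s ≠ 0 := hs.1.ne'
  have hG : IntegrableOn (fun u : ℝ => Real.exp (-u) * u ^ (-s)) (Ioi 0) := by
    simpa using Real.GammaIntegral_convergent (s := 1 - s) (by linarith [hs.2])
  have hI : IntegrableOn (fun u : ℝ => (1 - Real.exp (-u)) * u ^ (-s - 1)) (Ioi 0) := by
    refine (integrableOn_expMellin hs (z := 1) (by simp)).re.congr (ae_of_all _ fun u => ?_)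
    have : (1 : ℂ) - Complex.exp (-(1 * u)) = ((1 - Real.exp (-u) : ℝ) : ℂ) := by
      push_cast; simp
    simp only [this, ← Complex.ofReal_mul]
    rw [mul_comm]; exact Complex.ofReal_re _
  have key := integral_Ioi_mul_deriv_eq_deriv_mul (a := (0 : ℝ)) (a' := 0) (b' := 0)
    (u := fun u : ℝ => 1 - Real.exp (-u)) (u' := fun u => Real.exp (-u))
    (v := fun u : ℝ => -(u ^ (-s) / s)) (v' := fun u => u ^ (-s - 1)) ?_ ?_ hI ?_ ?_ ?_
  · have h1 : expMellin s 1 = ((∫ u in Ioi (0 : ℝ), (1 - Real.exp (-u)) * u ^ (-s - 1) : ℝ) : ℂ) := by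
      rw [expMellin, ← integral_complex_ofReal]
      congr 1; ext u; push_cast; simp [mul_comm]
    rw [h1, key, Real.Gamma_eq_integral (by linarith [hs.2])]
    congr 1
    rw [sub_zero, zero_sub, ← integral_neg, ← integral_div]
    congr 1; ext u
    rw [show 1 - s - 1 = -s by ring]; ring
  · intro u _
    simpa using ((Real.hasDerivAt_exp (-u)).comp u (hasDerivAt_neg u)).const_sub 1
  · intro u hu
    have := ((Real.hasDerivAt_rpow_const (x := u) (p := -s) (Or.inl (ne_of_gt hu))).div_const s).neg
    refine this.congr_deriv ?_
    field_simp
  · have := hG.neg.div_const s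
    refine this.congr (ae_of_all _ fun u => ?_)
    simp only [Pi.neg_apply, Pi.mul_apply]; ring
  · have h1 : Tendsto (fun u : ℝ => u ^ (1 - s) / s) (𝓝[>] 0) (𝓝 0) := by
      have := ((Real.continuousAt_rpow_const 0 (1 - s) (Or.inr (by linarith [hs.2]))).tendsto.div_const
        s).mono_left (nhdsWithin_le_nhds (s := Ioi 0))
      simpa [Real.zero_rpow (show 1 - s ≠ 0 by linarith [hs.2])] using this
    refine squeeze_zero_norm' ?_ h1
    filter_upwards [self_mem_nhdsWithin] with u hu
    have h0 : (0 : ℝ) < u := hu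
    have hs1 := hs.1
    have h2 : 0 ≤ 1 - Real.exp (-u) := by
      have := Real.exp_le_one_iff.2 (show -u ≤ 0 by linarith); linarith
    have h3 : 1 - Real.exp (-u) ≤ u := by linarith [Real.add_one_le_exp (-u)]
    have h4 : u ^ (1 - s) = u * u ^ (-s) := by
      rw [sub_eq_add_neg, Real.rpow_add h0, Real.rpow_one]
    rw [Pi.mul_apply, mul_neg, norm_neg, Real.norm_of_nonneg (by positivity), h4, ← mul_div_assoc]
    gcongr
  · have h1 : Tendsto (fun u : ℝ => u ^ (-s) / s) atTop (𝓝 0) := by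
      simpa using (tendsto_rpow_neg_atTop hs.1).div_const s
    refine squeeze_zero_norm' ?_ h1
    filter_upwards [eventually_gt_atTop 0] with u h0
    have hs1 := hs.1
    have h2 : 0 ≤ 1 - Real.exp (-u) := by
      have := Real.exp_le_one_iff.2 (show -u ≤ 0 by linarith); linarith
    rw [Pi.mul_apply, mul_neg, norm_neg, Real.norm_of_nonneg (by positivity)]
    exact mul_le_of_le_one_left (by positivity) (by linarith [Real.exp_pos (-u)])

lemma expMellin_ofReal {s : ℝ} (hs : s ∈ Ioo (0 : ℝ) 1) {x : ℝ} (hx : 0 < x) :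
    expMellin s x = ((Real.Gamma (1 - s) / s : ℝ) : ℂ) * (x : ℂ) ^ (s : ℂ) := by
  have h := integral_comp_mul_left_Ioi
    (fun u : ℝ => ((u ^ (-s - 1) : ℝ) : ℂ) * (1 - Complex.exp (-(1 * u)))) 0 hx
  rw [mul_zero] at h
  have h2 : ∫ u in Ioi (0 : ℝ), (((x * u) ^ (-s - 1) : ℝ) : ℂ) *
      (1 - Complex.exp (-(1 * ((x * u : ℝ) : ℂ)))) = ((x ^ (-s - 1) : ℝ) : ℂ) * expMellin s x := by
    rw [expMellin, ← integral_const_mul]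
    refine setIntegral_congr_fun measurableSet_Ioi fun u hu => ?_
    rw [Real.mul_rpow hx.le (le_of_lt hu)]
    push_cast
    rw [one_mul]; ring
  rw [h2] at h
  change _ = x⁻¹ • expMellin s 1 at h
  rw [expMellin_one hs] at h
  have hx1 : ((x ^ (-s - 1) : ℝ) : ℂ) ≠ 0 := by
    exact_mod_cast (Real.rpow_pos_of_pos hx _).ne'
  apply mul_left_cancel₀ hx1
  rw [h, ← Complex.ofReal_cpow hx.le, Complex.real_smul, ← Complex.ofReal_mul,
    ← Complex.ofReal_mul, ← Complex.ofReal_mul]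
  congr 1
  have : x ^ (-s - 1) * x ^ s = x⁻¹ := by
    rw [← Real.rpow_add hx, show -s - 1 + s = -1 by ring, Real.rpow_neg_one]
  rw [← this]; ring

/-- Identity theorem: both sides are analytic and agree on the positive reals, here sampled along `1
+ 1 / (n + 1)`, which accumulates at `1`. -/
lemma expMellin_of_re_pos {s : ℝ} (hs : s ∈ Ioo (0 : ℝ) 1) {z : ℂ} (hz : 0 < z.re) :
    expMellin s z = ((Real.Gamma (1 - s) / s : ℝ) : ℂ) * z ^ (s : ℂ) := by
  have hopen : IsOpen {z : ℂ | 0 < z.re} := isOpen_lt continuous_const Complex.continuous_re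
  have h1 : AnalyticOnNhd ℂ (expMellin s) {z | 0 < z.re} :=
    DifferentiableOn.analyticOnNhd
      (fun w hw => (differentiableAt_expMellin hs hw).differentiableWithinAt) hopen
  have h2 : AnalyticOnNhd ℂ (fun z : ℂ => ((Real.Gamma (1 - s) / s : ℝ) : ℂ) * z ^ (s : ℂ))
      {z | 0 < z.re} := by
    refine DifferentiableOn.analyticOnNhd (fun w hw => ?_) hopen
    refine DifferentiableAt.differentiableWithinAt ?_
    refine DifferentiableAt.const_mul ?_ _
    exact differentiableAt_id.cpow_const (Or.inl hw)
  refine h1.eqOn_of_preconnected_of_frequently_eq h2 (z₀ := 1)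
    ((convex_halfSpace_re_gt 0).isPreconnected) (by simp) ?_ hz
  have ht : Tendsto (fun n : ℕ => ((1 + 1 / ((n : ℝ) + 1) : ℝ) : ℂ)) atTop (𝓝[≠] 1) := by
    refine tendsto_nhdsWithin_iff.2 ⟨?_, Eventually.of_forall fun n => ?_⟩
    · have := (tendsto_one_div_add_atTop_nhds_zero_nat (𝕜 := ℝ)).const_add 1
      rw [add_zero] at this
      exact (Complex.continuous_ofReal.tendsto 1).comp this
    · have : (1 + 1 / ((n : ℝ) + 1) : ℝ) ≠ 1 := by
        have : (0 : ℝ) < 1 / ((n : ℝ) + 1) := by positivity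
        linarith
      exact fun h => this (Complex.ofReal_injective (by simpa using h))
  exact ht.frequently (Frequently.of_forall fun n => expMellin_ofReal hs (by positivity))

/-- A nonzero point of the imaginary axis is off the branch cut, so both sides pass to the limit
from the right. -/
lemma expMellin_eq {s : ℝ} (hs : s ∈ Ioo (0 : ℝ) 1) {z : ℂ} (hz : 0 ≤ z.re) (hz0 : z ≠ 0) :
    expMellin s z = ((Real.Gamma (1 - s) / s : ℝ) : ℂ) * z ^ (s : ℂ) := by
  rcases hz.eq_or_lt with h | h
  swap
  · exact expMellin_of_re_pos hs h
  have him : z.im ≠ 0 := fun h' => hz0 (Complex.ext h.symm h')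
  have ht : Tendsto (fun n : ℕ => z + ((1 / ((n : ℝ) + 1) : ℝ) : ℂ)) atTop (𝓝 z) := by
    have := (tendsto_one_div_add_atTop_nhds_zero_nat (𝕜 := ℝ))
    have h3 := ((Complex.continuous_ofReal.tendsto 0).comp this).const_add z
    simpa using h3
  have hpos : ∀ n : ℕ, 0 < (z + ((1 / ((n : ℝ) + 1) : ℝ) : ℂ)).re := fun n => by
    rw [Complex.add_re, Complex.ofReal_re, ← h]; positivity
  have h1 := (continuousWithinAt_expMellin hs z).tendsto.comp
    (tendsto_nhdsWithin_iff.2 ⟨ht, Eventually.of_forall fun n => (hpos n).le⟩)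
  have h2 : ContinuousAt (fun z : ℂ => ((Real.Gamma (1 - s) / s : ℝ) : ℂ) * z ^ (s : ℂ)) z :=
    continuousAt_const.mul (continuousAt_cpow_const (Or.inr him))
  refine tendsto_nhds_unique h1 ((h2.tendsto.comp ht).congr fun n => ?_)
  exact (expMellin_of_re_pos hs (hpos n)).symm

lemma I_cpow_ofReal (s : ℝ) : Complex.I ^ (s : ℂ)
    = Complex.exp ((Real.pi * s / 2 : ℝ) * Complex.I) := by
  rw [Complex.cpow_def_of_ne_zero Complex.I_ne_zero, Complex.log_I]
  push_cast; congr 1; ring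

lemma neg_I_cpow_ofReal (s : ℝ) : (-Complex.I) ^ (s : ℂ)
    = Complex.exp (-(Real.pi * s / 2 : ℝ) * Complex.I) := by
  rw [Complex.cpow_def_of_ne_zero (by simp), Complex.log_neg_I]
  push_cast; congr 1; ring

lemma ofReal_mul_cpow {x : ℝ} (hx : 0 < x) {z : ℂ} (hz : z ≠ 0) (w : ℂ) :
    ((x : ℂ) * z) ^ w = (x : ℂ) ^ w * z ^ w := by
  have hx0 : (x : ℂ) ≠ 0 := by exact_mod_cast hx.ne'
  rw [Complex.cpow_def_of_ne_zero (mul_ne_zero hx0 hz), Complex.cpow_def_of_ne_zero hx0,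
    Complex.cpow_def_of_ne_zero hz, Complex.log_ofReal_mul hx hz, ← Complex.exp_add,
    ← Complex.ofReal_log hx.le, add_mul]

/-- `∫₀^∞ u^{-s-1} (1 - e^{iux}) du`. -/
lemma expMellin_neg_mul_I {s : ℝ} (hs : s ∈ Ioo (0 : ℝ) 1) (x : ℝ) :
    expMellin s (-(x * Complex.I)) = ((Real.Gamma (1 - s) / s : ℝ) : ℂ) *
      ((|x| ^ s : ℝ) * Complex.exp (-(Real.pi * s / 2 * Real.sign x : ℝ) * Complex.I)) := by
  rcases lt_trichotomy x 0 with h | rfl | h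
  · rw [expMellin_eq hs (by simp) (by simp [h.ne]), Real.sign_of_neg h, abs_of_neg h,
      show -((x : ℂ) * Complex.I) = ((-x : ℝ) : ℂ) * Complex.I by push_cast; ring,
      ofReal_mul_cpow (by linarith) Complex.I_ne_zero, I_cpow_ofReal,
      ← Complex.ofReal_cpow (by linarith)]
    push_cast; ring_nf
  · simp [expMellin, Real.zero_rpow hs.1.ne']
  · rw [expMellin_eq hs (by simp) (by simp [h.ne']), Real.sign_of_pos h, abs_of_pos h,
      show -((x : ℂ) * Complex.I) = (x : ℂ) * (-Complex.I) by ring,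
      ofReal_mul_cpow h (by simp), neg_I_cpow_ofReal,
      ← Complex.ofReal_cpow h.le]
    push_cast; ring_nf

/-- Substituting `v = u ^ a` reduces this to `expMellin (s / a) c`. -/
lemma integral_rpow_mul_one_sub_exp_rpow {a s : ℝ} (ha : 0 < a) (hs : s ∈ Ioo 0 a) {c : ℂ}
    (hc : 0 < c.re) :
    ∫ u in Ioi (0 : ℝ), ((u ^ (-s - 1) : ℝ) : ℂ) * (1 - Complex.exp (-(c * ((u ^ a : ℝ) : ℂ))))
      = ((Real.Gamma (1 - s / a) / s : ℝ) : ℂ) * c ^ ((s / a : ℝ) : ℂ) := by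
  have hs' : s / a ∈ Ioo (0 : ℝ) 1 := ⟨div_pos hs.1 ha, (div_lt_one ha).2 hs.2⟩
  have h := integral_comp_rpow_Ioi_of_pos
    (g := fun u : ℝ => ((u ^ (-(s / a) - 1) : ℝ) : ℂ) * (1 - Complex.exp (-(c * u)))) ha
  change _ = expMellin (s / a) c at h
  rw [expMellin_of_re_pos hs' hc] at h
  have hs0 := hs.1.ne'
  have h2 : ((Real.Gamma (1 - s / a) / s : ℝ) : ℂ) * c ^ ((s / a : ℝ) : ℂ)
      = (a : ℂ)⁻¹ * (((Real.Gamma (1 - s / a) / (s / a) : ℝ) : ℂ) * c ^ ((s / a : ℝ) : ℂ)) := by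
    have ha0 : (a : ℂ) ≠ 0 := by exact_mod_cast ha.ne'
    have hs1 : (s : ℂ) ≠ 0 := by exact_mod_cast hs0
    push_cast; field_simp
  rw [h2, ← h, ← integral_const_mul]
  refine setIntegral_congr_fun measurableSet_Ioi fun u hu => ?_
  have h0 : (0 : ℝ) < u := hu
  have h3 : u ^ (-s - 1) = u ^ (a - 1) * (u ^ a) ^ (-(s / a) - 1) := by
    rw [← Real.rpow_mul h0.le, ← Real.rpow_add h0]; congr 1; field_simp; ring
  have ha0 : (a : ℂ) ≠ 0 := by exact_mod_cast ha.ne'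
  simp only [h3, Complex.real_smul]
  push_cast
  field_simp

/-- Real part of `expMellin` at `-2i`, since `1 - cos (2 u) = 2 sin² u`. It evaluates the
denominator of `momentConst`. -/
lemma integral_rpow_mul_sin_sq {s : ℝ} (hs : s ∈ Ioo (0 : ℝ) 1) :
    ∫ u in Ioi (0 : ℝ), u ^ (-s - 1) * Real.sin u ^ 2
      = 2 ^ (s - 1) * (Real.Gamma (1 - s) / s) * Real.cos (Real.pi * s / 2) := by
  have h := congrArg Complex.re (expMellin_neg_mul_I hs 2)
  rw [expMellin] at h
  have hint := integrableOn_expMellin hs (z := -((2 : ℝ) * Complex.I)) (by simp)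
  have h1 : ∀ u : ℝ, (((u ^ (-s - 1) : ℝ) : ℂ) *
      (1 - Complex.exp (-(-((2 : ℝ) * Complex.I) * u)))).re
        = 2 * (u ^ (-s - 1) * Real.sin u ^ 2) := fun u => by
    rw [Complex.re_ofReal_mul, Complex.sub_re, Complex.one_re,
      show -(-((2 : ℝ) * Complex.I) * u) = ((2 * u : ℝ) : ℂ) * Complex.I by push_cast; ring,
      Complex.exp_ofReal_mul_I_re, Real.cos_two_mul, Real.cos_sq']
    ring
  have h2 := integral_re hint
  simp only [RCLike.re_eq_complex_re, h1] at h2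
  rw [integral_const_mul] at h2
  rw [← h2] at h
  rw [show -((Real.pi * s / 2 * Real.sign 2 : ℝ) : ℂ) * Complex.I
      = ((-(Real.pi * s / 2) : ℝ) : ℂ) * Complex.I by
        rw [Real.sign_of_pos two_pos]; push_cast; ring,
    Complex.re_ofReal_mul, Complex.re_ofReal_mul, Complex.exp_ofReal_mul_I_re, Real.cos_neg,
    abs_of_pos two_pos] at h
  rw [Real.rpow_sub_one two_ne_zero]
  linarith

lemma integral_rpow_mul_comp_mul {s t : ℝ} (ht : 0 < t) (k : ℝ → ℝ) :
    ∫ u in Ioi (0 : ℝ), u ^ (-s - 1) * k (t * u)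
      = t ^ s * ∫ u in Ioi (0 : ℝ), u ^ (-s - 1) * k u := by
  have h := integral_comp_mul_left_Ioi' (fun u : ℝ => u ^ (-s - 1) * k u) 0 ht
  rw [mul_zero] at h
  rw [← h, smul_eq_mul, ← mul_assoc, ← integral_const_mul]
  refine setIntegral_congr_fun measurableSet_Ioi fun u hu => ?_
  have h1 : t ^ s * t * t ^ (-s - 1) = 1 := by
    rw [← Real.rpow_add_one ht.ne', ← Real.rpow_add ht]; simp
  simp only [Real.mul_rpow ht.le (le_of_lt hu)]
  linear_combination (-(u ^ (-s - 1) * k (t * u))) * h1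

/-! ### Fractional moments of the stable mixing variables -/

/-- The exponent of the totally skewed stable law of index `a` normalized so that its Laplace
transform is `exp (-u ^ a)`. -/
noncomputable def stableExponent (a : ℝ) : ℂ :=
  Complex.exp (((-(Real.pi * a / 2) : ℝ) : ℂ) * Complex.I)

lemma stableExponent_re_pos {a : ℝ} (ha : a ∈ Ioo (0 : ℝ) 1) : 0 < (stableExponent a).re := by
  rw [stableExponent, Complex.exp_ofReal_mul_I_re, Real.cos_neg]
  have := Real.pi_pos
  exact Real.cos_pos_of_mem_Ioo ⟨by nlinarith [ha.1], by nlinarith [ha.2]⟩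

lemma stableExponent_cpow {a s : ℝ} (ha : a ∈ Ioo (0 : ℝ) 1) :
    stableExponent a ^ ((s / a : ℝ) : ℂ)
      = Complex.exp (((-(Real.pi * s / 2) : ℝ) : ℂ) * Complex.I) := by
  have ha0 : (a : ℂ) ≠ 0 := by exact_mod_cast ha.1.ne'
  have := Real.pi_pos
  rw [stableExponent, Complex.cpow_def_of_ne_zero (Complex.exp_ne_zero _), Complex.log_exp]
  · congr 1; push_cast; field_simp
  · simp; nlinarith [ha.2]
  · simp; nlinarith [ha.1]

/-- The scale is chosen so that its power `α / 2` is `cos (π α / 4)`, and `cos t * (1 - i tan t) =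
exp (-i t)`. -/
lemma IsStableLaw.charFun_of_pos {α : ℝ} (hα : α ∈ Ioo (1 : ℝ) 2) {ν : Measure ℝ}
    (h : IsStableLaw (α / 2) (Real.cos (Real.pi * α / 4) ^ (2 / α)) 1 0 ν) {u : ℝ} (hu : 0 < u) :
    charFun ν u = Complex.exp (-(stableExponent (α / 2) * ((u ^ (α / 2) : ℝ) : ℂ))) := by
  have hα0 : 0 < α := by linarith [hα.1]
  have := Real.pi_pos
  have hcos : 0 < Real.cos (Real.pi * α / 4) :=
    Real.cos_pos_of_mem_Ioo ⟨by nlinarith, by nlinarith [hα.2]⟩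
  have h1 : (Real.cos (Real.pi * α / 4) ^ (2 / α)) ^ (α / 2) = Real.cos (Real.pi * α / 4) := by
    rw [← Real.rpow_mul hcos.le, show 2 / α * (α / 2) = 1 by field_simp, Real.rpow_one]
  have h2 : Real.pi * (α / 2) / 2 = Real.pi * α / 4 := by ring
  rw [h.2 u, stableCharFun, if_neg (by linarith [hα.2]), h1, Real.sign_of_pos hu, abs_of_pos hu,
    h2, stableExponent, h2, Complex.exp_mul_I, ← Complex.ofReal_cos, ← Complex.ofReal_sin,
    Real.cos_neg, Real.sin_neg, Real.tan_eq_sin_div_cos]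
  congr 1
  have hcos' : (Real.cos (Real.pi * α / 4) : ℂ) ≠ 0 := by exact_mod_cast hcos.ne'
  push_cast at hcos' ⊢
  field_simp
  ring

section Moments

variable {ν : Measure ℝ} [IsProbabilityMeasure ν] {a s : ℝ}

lemma one_sub_charFun_eq_integral (u : ℝ) :
    1 - charFun ν u = ∫ x, (1 - Complex.exp (-(-((x : ℂ) * Complex.I) * u))) ∂ν := by
  have hint : Integrable (fun x : ℝ => Complex.exp (u * x * Complex.I)) ν := by
    refine Integrable.of_bound (by fun_prop) 1 (ae_of_all _ fun x => ?_)
    rw [← Complex.ofReal_mul, Complex.norm_exp_ofReal_mul_I]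
  have h : ∀ x : ℝ, -(-((x : ℂ) * Complex.I) * u) = u * x * Complex.I := fun x => by ring
  simp_rw [h]
  rw [integral_sub (integrable_const _) hint, charFun_apply_real]
  simp

lemma integrableOn_one_sub_exp_rpow (hs : s ∈ Ioo 0 a) {c : ℂ} (hc : 0 ≤ c.re) :
    IntegrableOn (fun u : ℝ => ((u ^ (-s - 1) : ℝ) : ℂ) *
      (1 - Complex.exp (-(c * ((u ^ a : ℝ) : ℂ))))) (Ioi 0) := by
  refine Integrable.mono' ((integrableOn_rpow_mul_min hs.1 hs.2).const_mul (2 * max 1 ‖c‖))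
    (Measurable.aestronglyMeasurable (by fun_prop)) ?_
  filter_upwards [ae_restrict_mem measurableSet_Ioi] with u hu
  have h0 : (0 : ℝ) < u := hu
  have h1 : 0 ≤ (c * ((u ^ a : ℝ) : ℂ)).re := by
    rw [Complex.re_mul_ofReal]; positivity
  have h2 := norm_one_sub_exp_neg_le h1
  rw [norm_mul, Complex.norm_of_nonneg (by positivity)] at h2
  have h3 : min 1 (‖c‖ * u ^ a) ≤ max 1 ‖c‖ * min 1 (u ^ a) := by
    rw [mul_min_of_nonneg _ _ (by positivity)]
    refine min_le_min (by simp) ?_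
    gcongr; exact le_max_right _ _
  rw [norm_mul, Complex.norm_of_nonneg (by positivity)]
  calc _ ≤ u ^ (-s - 1) * (2 * (max 1 ‖c‖ * min 1 (u ^ a))) := by gcongr; linarith
    _ = _ := by ring

lemma one_sub_exp_neg_mul_I_re (x u : ℝ) :
    (1 - Complex.exp (-(-((x : ℂ) * Complex.I) * u))).re = 1 - Real.cos (x * u) := by
  rw [Complex.sub_re, Complex.one_re, show -(-((x : ℂ) * Complex.I) * u)
    = ((x * u : ℝ) : ℂ) * Complex.I by push_cast; ring, Complex.exp_ofReal_mul_I_re]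

lemma expMellin_neg_mul_I_re (hs : s ∈ Ioo (0 : ℝ) 1) (x : ℝ) :
    (expMellin s (-(x * Complex.I))).re
      = Real.Gamma (1 - s) / s * Real.cos (Real.pi * s / 2) * |x| ^ s := by
  rw [expMellin_neg_mul_I hs, show -((Real.pi * s / 2 * Real.sign x : ℝ) : ℂ) * Complex.I
    = ((-(Real.pi * s / 2 * Real.sign x) : ℝ) : ℂ) * Complex.I by push_cast; ring,
    Complex.re_ofReal_mul, Complex.re_ofReal_mul, Complex.exp_ofReal_mul_I_re, Real.cos_neg]
  rcases lt_trichotomy x 0 with h | rfl | h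
  · rw [Real.sign_of_neg h, mul_neg_one, Real.cos_neg]; ring
  · simp [Real.zero_rpow hs.1.ne']
  · rw [Real.sign_of_pos h, mul_one]; ring

/-- Tonelli for the nonnegative kernel `u ^ (-s - 1) * (1 - cos (x u))`: integrating in `u` gives a
positive multiple of `|x| ^ s`, integrating in `x` gives the real part of `1 - charFun`, which is
`O(u ^ a)` near zero with `s < a`. -/
lemma integrable_abs_rpow_of_charFun (ha : a ∈ Ioo (0 : ℝ) 1) (hs : s ∈ Ioo 0 a)
    (hν : ∀ u : ℝ, 0 < u →
      charFun ν u = Complex.exp (-(stableExponent a * ((u ^ a : ℝ) : ℂ)))) :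
    Integrable (fun x : ℝ => |x| ^ s) ν := by
  have hs' : s ∈ Ioo (0 : ℝ) 1 := ⟨hs.1, hs.2.trans ha.2⟩
  have hint : Integrable (fun z : ℝ × ℝ => z.2 ^ (-s - 1) * (1 - Real.cos (z.1 * z.2)))
      (ν.prod (volume.restrict (Ioi 0))) := by
    rw [integrable_prod_iff' (Measurable.aestronglyMeasurable (by fun_prop))]
    constructor
    · refine ae_of_all _ fun u => ?_
      have hm : AEStronglyMeasurable (fun x : ℝ => 1 - Real.cos (x * u)) ν := by fun_prop
      refine Integrable.const_mul (Integrable.of_bound hm 2 (ae_of_all _ fun x => ?_))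
        (u ^ (-s - 1))
      have h1 := Real.cos_le_one (x * u)
      have h2 := Real.neg_one_le_cos (x * u)
      rw [Real.norm_eq_abs, abs_le]; constructor <;> linarith
    · refine (integrableOn_one_sub_exp_rpow hs (stableExponent_re_pos ha).le).re.congr ?_
      filter_upwards [ae_restrict_mem measurableSet_Ioi] with u hu
      have h0 : (0 : ℝ) < u := hu
      rw [RCLike.re_eq_complex_re, ← hν u h0, Complex.re_ofReal_mul, one_sub_charFun_eq_integral]
      have h1 : ∀ x : ℝ, ‖u ^ (-s - 1) * (1 - Real.cos (x * u))‖
          = u ^ (-s - 1) * (1 - Complex.exp (-(-((x : ℂ) * Complex.I) * u))).re := fun x => by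
        have h1 := Real.cos_le_one (x * u)
        rw [one_sub_exp_neg_mul_I_re, Real.norm_of_nonneg]
        exact mul_nonneg (by positivity) (by linarith)
      simp_rw [h1]
      rw [integral_const_mul]
      congr 1
      have hi : Integrable (fun x : ℝ => 1 - Complex.exp (-(-((x : ℂ) * Complex.I) * u))) ν := by
        refine Integrable.of_bound (by fun_prop) 2 (ae_of_all _ fun x => ?_)
        have := norm_one_sub_exp_neg_le (z := -((x : ℂ) * Complex.I) * u) (by simp)
        exact this.trans (by linarith [min_le_left 1 ‖-((x : ℂ) * Complex.I) * u‖])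
      exact (integral_re hi).symm
  have h1 := hint.integral_prod_left
  have hG : 0 < Real.Gamma (1 - s) := Real.Gamma_pos_of_pos (by linarith [hs'.2])
  have hs0 := hs'.1
  have := Real.pi_pos
  have hcos : 0 < Real.cos (Real.pi * s / 2) :=
    Real.cos_pos_of_mem_Ioo ⟨by nlinarith, by nlinarith [hs'.2]⟩
  have hK : 0 < Real.Gamma (1 - s) / s * Real.cos (Real.pi * s / 2) := by positivity
  refine (h1.const_mul (Real.Gamma (1 - s) / s * Real.cos (Real.pi * s / 2))⁻¹).congr
    (ae_of_all _ fun x => ?_)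
  dsimp only
  rw [inv_mul_eq_iff_eq_mul₀ hK.ne', ← expMellin_neg_mul_I_re hs', expMellin]
  have h2 := integral_re (integrableOn_expMellin hs' (z := -((x : ℂ) * Complex.I)) (by simp))
  simp only [RCLike.re_eq_complex_re] at h2
  rw [← h2]
  congr 1; ext u
  rw [Complex.re_ofReal_mul, one_sub_exp_neg_mul_I_re]

/-- Fubini for the full complex kernel, now legitimate because its absolute `u`-integral is at most
a constant times the integrable `|x| ^ s`. -/
lemma integral_expMellin_of_charFun (ha : a ∈ Ioo (0 : ℝ) 1) (hs : s ∈ Ioo 0 a)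
    (hν : ∀ u : ℝ, 0 < u →
      charFun ν u = Complex.exp (-(stableExponent a * ((u ^ a : ℝ) : ℂ)))) :
    ∫ x : ℝ, expMellin s (-(x * Complex.I)) ∂ν = ((Real.Gamma (1 - s / a) / s : ℝ) : ℂ) *
      Complex.exp (((-(Real.pi * s / 2) : ℝ) : ℂ) * Complex.I) := by
  have hs' : s ∈ Ioo (0 : ℝ) 1 := ⟨hs.1, hs.2.trans ha.2⟩
  have hint : Integrable (fun z : ℝ × ℝ => ((z.2 ^ (-s - 1) : ℝ) : ℂ) *
      (1 - Complex.exp (-(-((z.1 : ℂ) * Complex.I) * z.2))))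
      (ν.prod (volume.restrict (Ioi 0))) := by
    have hm : Measurable (fun z : ℝ × ℝ => ((z.2 ^ (-s - 1) : ℝ) : ℂ) *
      (1 - Complex.exp (-(-((z.1 : ℂ) * Complex.I) * z.2)))) := by fun_prop
    refine (integrable_prod_iff hm.aestronglyMeasurable).2 ?_
    refine ⟨ae_of_all _ fun x =>
      integrableOn_expMellin hs' (z := -((x : ℂ) * Complex.I)) (by simp), ?_⟩
    have hm2 : StronglyMeasurable fun x : ℝ => ∫ u in Ioi (0 : ℝ), ‖((u ^ (-s - 1) : ℝ) : ℂ) *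
        (1 - Complex.exp (-(-((x : ℂ) * Complex.I) * u)))‖ :=
      hm.norm.stronglyMeasurable.integral_prod_right'
    have hdom := (integrable_abs_rpow_of_charFun ha hs hν).const_mul
      (2 * ∫ u in Ioi (0 : ℝ), u ^ (-s - 1) * min 1 (u ^ (1 : ℝ)))
    refine Integrable.mono' (μ := ν) hdom hm2.aestronglyMeasurable (ae_of_all ν fun x => ?_)
    rw [Real.norm_of_nonneg (integral_nonneg fun u => norm_nonneg _)]
    rcases eq_or_ne x 0 with rfl | hx
    · simp [Real.zero_rpow hs'.1.ne']
    have hx' : 0 < |x| := abs_pos.2 hx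
    -- By scaling, the factor `|x| ^ s` is absorbed into the integral as `min 1 (|x| u)`, which
    -- allows a pointwise comparison.
    rw [mul_assoc, mul_comm _ (|x| ^ s),
      ← integral_rpow_mul_comp_mul hx' (fun u => min 1 (u ^ (1 : ℝ))), ← integral_const_mul]
    refine integral_mono_of_nonneg (ae_of_all _ fun u => norm_nonneg _) ?_ ?_
    · have h1 := integrableOn_rpow_mul_min hs'.1 hs'.2
      refine Integrable.mono' ((h1.const_mul (max 1 |x|)).const_mul 2)
        (Measurable.aestronglyMeasurable (by fun_prop)) ?_
      filter_upwards [ae_restrict_mem measurableSet_Ioi] with u hu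
      have h0 : (0 : ℝ) < u := hu
      rw [Real.norm_of_nonneg (by positivity), Real.rpow_one, Real.rpow_one]
      have h3 : min 1 (|x| * u) ≤ max 1 |x| * min 1 u := by
        rw [mul_min_of_nonneg _ _ (by positivity)]
        refine min_le_min (by simp) ?_
        gcongr; exact le_max_right _ _
      calc _ ≤ 2 * (u ^ (-s - 1) * (max 1 |x| * min 1 u)) := by gcongr
        _ = _ := by ring
    · filter_upwards [ae_restrict_mem measurableSet_Ioi] with u hu
      have h0 : (0 : ℝ) < u := hu
      have h2 := norm_one_sub_exp_neg_le (z := -((x : ℂ) * Complex.I) * u) (by simp)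
      rw [show ‖-((x : ℂ) * Complex.I) * u‖ = |x| * u by
        rw [norm_mul, norm_neg, norm_mul, Complex.norm_I, mul_one, Complex.norm_of_nonneg h0.le,
          Complex.norm_real, Real.norm_eq_abs]] at h2
      rw [norm_mul, Complex.norm_of_nonneg (by positivity), Real.rpow_one]
      calc _ ≤ u ^ (-s - 1) * (2 * min 1 (|x| * u)) := by gcongr
        _ = _ := by ring
  have hswap := integral_integral_swap (f := fun x u : ℝ => ((u ^ (-s - 1) : ℝ) : ℂ) *
      (1 - Complex.exp (-(-((x : ℂ) * Complex.I) * u)))) hint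
  change ∫ x : ℝ, expMellin s (-(x * Complex.I)) ∂ν = _ at hswap
  rw [hswap, ← stableExponent_cpow ha,
    ← integral_rpow_mul_one_sub_exp_rpow ha.1 hs (stableExponent_re_pos ha)]
  refine setIntegral_congr_fun measurableSet_Ioi fun u hu => ?_
  rw [integral_const_mul, ← one_sub_charFun_eq_integral, hν u hu]

lemma rpow_posPart_le (hs : 0 < s) (x : ℝ) : max x 0 ^ s ≤ |x| ^ s := by
  gcongr; exact max_le (le_abs_self x) (abs_nonneg x)

lemma integrable_max_rpow_of_charFun (ha : a ∈ Ioo (0 : ℝ) 1) (hs : s ∈ Ioo 0 a)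
    (hν : ∀ u : ℝ, 0 < u →
      charFun ν u = Complex.exp (-(stableExponent a * ((u ^ a : ℝ) : ℂ)))) :
    Integrable (fun x : ℝ => max x 0 ^ s) ν := by
  refine Integrable.mono' (integrable_abs_rpow_of_charFun ha hs hν)
    (Measurable.aestronglyMeasurable (by fun_prop)) (ae_of_all _ fun x => ?_)
  rw [Real.norm_of_nonneg (by positivity)]
  exact rpow_posPart_le hs.1 x

/-- Positive and negative `x` enter with phases `e` and `e * e'`, and the right side has phase `e`.
After dividing by `e`, the imaginary part is `sin (π s)` times the moment of the negative part,
which must vanish. Positivity of the stable variable is thus derived, not assumed. -/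
lemma integral_max_rpow_of_charFun (ha : a ∈ Ioo (0 : ℝ) 1) (hs : s ∈ Ioo 0 a)
    (hν : ∀ u : ℝ, 0 < u →
      charFun ν u = Complex.exp (-(stableExponent a * ((u ^ a : ℝ) : ℂ)))) :
    ∫ x : ℝ, max x 0 ^ s ∂ν = Real.Gamma (1 - s / a) / Real.Gamma (1 - s) := by
  have hs' : s ∈ Ioo (0 : ℝ) 1 := ⟨hs.1, hs.2.trans ha.2⟩
  have hs0 := hs'.1
  have hG : 0 < Real.Gamma (1 - s) := Real.Gamma_pos_of_pos (by linarith [hs'.2])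
  have hpos := integrable_max_rpow_of_charFun ha hs hν
  have hneg : Integrable (fun x : ℝ => max (-x) 0 ^ s) ν := by
    refine Integrable.mono' (integrable_abs_rpow_of_charFun ha hs hν)
      (Measurable.aestronglyMeasurable (by fun_prop)) (ae_of_all _ fun x => ?_)
    rw [Real.norm_of_nonneg (by positivity)]
    simpa using rpow_posPart_le hs.1 (-x)
  have h := integral_expMellin_of_charFun ha hs hν
  set e : ℂ := Complex.exp (((-(Real.pi * s / 2) : ℝ) : ℂ) * Complex.I) with he
  set e' : ℂ := Complex.exp (((Real.pi * s : ℝ) : ℂ) * Complex.I) with he'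
  have hpt : ∀ x : ℝ, expMellin s (-(x * Complex.I)) = ((Real.Gamma (1 - s) / s : ℝ) : ℂ) * e *
      (((max x 0 ^ s : ℝ) : ℂ) + ((max (-x) 0 ^ s : ℝ) : ℂ) * e') := fun x => by
    rw [expMellin_neg_mul_I hs', mul_assoc]
    congr 1
    rcases lt_trichotomy x 0 with hx | rfl | hx
    · rw [max_eq_right hx.le, max_eq_left (by linarith), Real.zero_rpow hs0.ne', abs_of_neg hx,
        Real.sign_of_neg hx, Complex.ofReal_zero, zero_add, mul_left_comm, he, he',
        ← Complex.exp_add]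
      congr 2; push_cast; ring
    · simp [Real.zero_rpow hs0.ne']
    · rw [max_eq_left hx.le, max_eq_right (by linarith), Real.zero_rpow hs0.ne', abs_of_pos hx,
        Real.sign_of_pos hx, Complex.ofReal_zero, zero_mul, add_zero, mul_comm, he]
      congr 2; push_cast; ring
  simp_rw [hpt] at h
  rw [integral_const_mul, integral_add hpos.ofReal (hneg.ofReal.mul_const _),
    integral_mul_const, integral_complex_ofReal, integral_complex_ofReal] at h
  have he0 : e ≠ 0 := Complex.exp_ne_zero _
  have hsC : (s : ℂ) ≠ 0 := by exact_mod_cast hs0.ne'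
  have hGC : (Real.Gamma (1 - s) : ℂ) ≠ 0 := by exact_mod_cast hG.ne'
  have h2 : ((∫ x, max x 0 ^ s ∂ν : ℝ) : ℂ) + ((∫ x, max (-x) 0 ^ s ∂ν : ℝ) : ℂ) * e'
      = ((Real.Gamma (1 - s / a) / Real.Gamma (1 - s) : ℝ) : ℂ) := by
    rw [Complex.ofReal_div] at h ⊢
    rw [Complex.ofReal_div] at h
    field_simp at h ⊢
    linear_combination h
  have him := congrArg Complex.im h2
  have hre := congrArg Complex.re h2
  rw [Complex.add_im, Complex.im_ofReal_mul, Complex.ofReal_im, Complex.ofReal_im, he',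
    Complex.exp_ofReal_mul_I_im, zero_add] at him
  rw [Complex.add_re, Complex.re_ofReal_mul, Complex.ofReal_re, Complex.ofReal_re] at hre
  have hsin : Real.sin (Real.pi * s) ≠ 0 := by
    have := Real.pi_pos
    exact (Real.sin_pos_of_mem_Ioo ⟨by positivity, by nlinarith [hs'.2]⟩).ne'
  rw [(mul_eq_zero.1 him).resolve_right hsin, zero_mul, add_zero] at hre
  exact hre

end Moments

/-- The tangent and cosine powers cancel through `1 + tan² = cos⁻²`; the sine integral cancels `2 ^
(p / 2)` and `cos (p π / 4)`. -/
lemma momentConst_eq {α p : ℝ} (hα : α ∈ Ioo (1 : ℝ) 2) (hp : 0 < p) (hpα : p < α / 4) :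
    momentConst α p = Real.Gamma (1 - p / α) / Real.Gamma (1 - p / 2) := by
  have := Real.pi_pos
  have hα0 : 0 < α := by linarith [hα.1]
  have hcos : 0 < Real.cos (Real.pi * α / 4) :=
    Real.cos_pos_of_mem_Ioo ⟨by nlinarith, by nlinarith [hα.2]⟩
  have hcos2 : 0 < Real.cos (Real.pi * p / 4) :=
    Real.cos_pos_of_mem_Ioo ⟨by nlinarith, by nlinarith [hα.2]⟩
  have hG : 0 < Real.Gamma (1 - p / 2) := Real.Gamma_pos_of_pos (by linarith [hα.2])
  have h1 : (1 + Real.tan (α * Real.pi / 4) ^ 2) ^ (p / (2 * α))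
      * Real.cos (Real.pi * α / 4) ^ (p / α) = 1 := by
    rw [mul_comm α, ← inv_inv (1 + _ ^ 2), Real.inv_one_add_tan_sq hcos.ne',
      show p / α = 2 * (p / (2 * α)) by field_simp, Real.rpow_mul hcos.le, Real.rpow_two,
      ← Real.mul_rpow (by positivity) (by positivity), inv_mul_cancel₀ (by positivity),
      Real.one_rpow]
  have h2 := integral_rpow_mul_sin_sq (s := p / 2) ⟨by positivity, by linarith [hα.2]⟩
  rw [show Real.pi * (p / 2) / 2 = Real.pi * p / 4 by ring, ← neg_div,
    Real.rpow_sub_one two_ne_zero] at h2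
  have h3 : (2 : ℝ) ^ (p / 2) ≠ 0 := by positivity
  rw [momentConst, h2, mul_assoc _ (_ ^ (p / (2 * α))), h1, show p * Real.pi / 4 = Real.pi * p / 4 by ring]
  generalize Real.cos (Real.pi * p / 4) = c at hcos2
  generalize Real.Gamma (1 - p / 2) = G at hG
  field_simp

/-- The fractional moments of the stable mixing variables. -/
lemma IsStableLaw.integrable_max_rpow {α s : ℝ} (hα : α ∈ Ioo (1 : ℝ) 2) {ν : Measure ℝ}
    (h : IsStableLaw (α / 2) (Real.cos (Real.pi * α / 4) ^ (2 / α)) 1 0 ν)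
    (hs : s ∈ Ioo 0 (α / 2)) : Integrable (fun x : ℝ => max x 0 ^ s) ν :=
  have := h.1
  integrable_max_rpow_of_charFun ⟨by linarith [hα.1], by linarith [hα.2]⟩ hs
    fun _ hu => h.charFun_of_pos hα hu

lemma IsStableLaw.integral_max_rpow {α p : ℝ} (hα : α ∈ Ioo (1 : ℝ) 2) {ν : Measure ℝ}
    (h : IsStableLaw (α / 2) (Real.cos (Real.pi * α / 4) ^ (2 / α)) 1 0 ν)
    (hp : 0 < p) (hpα : p < α / 4) : ∫ x : ℝ, max x 0 ^ (p / 2) ∂ν = momentConst α p := by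
  have := h.1
  have hα0 : 0 < α := by linarith [hα.1]
  rw [momentConst_eq hα hp hpα, integral_max_rpow_of_charFun
    ⟨by linarith [hα.1], by linarith [hα.2]⟩ ⟨by positivity, by linarith⟩
    fun _ hu => h.charFun_of_pos hα hu]
  congr 3; field_simp

lemma momentConst_pos {α p : ℝ} (hα : α ∈ Ioo (1 : ℝ) 2) (hp : 0 < p) (hpα : p < α / 4) :
    0 < momentConst α p := by
  have hα0 : 0 < α := by linarith [hα.1]
  rw [momentConst_eq hα hp hpα]
  refine div_pos (Real.Gamma_pos_of_pos ?_) (Real.Gamma_pos_of_pos (by linarith [hα.2]))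
  have : p / α < 1 := (div_lt_one hα0).2 (by linarith)
  linarith

/-! ### Signed powers -/

lemma signedPow_eq {p : ℝ} (hp : 0 < p) (x : ℝ) :
    signedPow p x = max x 0 ^ p - max (-x) 0 ^ p := by
  rw [signedPow]
  rcases lt_trichotomy x 0 with h | rfl | h
  · rw [Real.sign_of_neg h, abs_of_neg h, max_eq_right h.le, max_eq_left (by linarith),
      Real.zero_rpow hp.ne']; ring
  · simp [Real.zero_rpow hp.ne']
  · rw [Real.sign_of_pos h, abs_of_pos h, max_eq_left h.le, max_eq_right (by linarith),
      Real.zero_rpow hp.ne']; ring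

lemma continuous_signedPow {p : ℝ} (hp : 0 < p) : Continuous (signedPow p) := by
  have h : signedPow p = fun x => max x 0 ^ p - max (-x) 0 ^ p := funext (signedPow_eq hp)
  rw [h]
  refine Continuous.sub ?_ ?_ <;>
    exact Continuous.rpow_const (by fun_prop) fun _ => Or.inr hp.le

lemma real_sign_mul (x y : ℝ) : Real.sign (x * y) = Real.sign x * Real.sign y := by
  rcases lt_trichotomy x 0 with hx | rfl | hx <;> rcases lt_trichotomy y 0 with hy | rfl | hy <;>
    simp [Real.sign_of_neg, Real.sign_of_pos, mul_pos_of_neg_of_neg, mul_neg_of_neg_of_pos,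
      mul_neg_of_pos_of_neg, *]

lemma signedPow_mul (p x y : ℝ) : signedPow p (x * y) = signedPow p x * signedPow p y := by
  simp only [signedPow, abs_mul, Real.mul_rpow (abs_nonneg x) (abs_nonneg y), real_sign_mul]
  ring

lemma signedPow_of_pos (p : ℝ) {x : ℝ} (hx : 0 < x) : signedPow p x = x ^ p := by
  rw [signedPow, Real.sign_of_pos hx, abs_of_pos hx, mul_one]

/-- For negative `x` both sides are zero, so the positive-part moments apply directly, without
almost sure positivity of `A i`. -/
lemma signedPow_sqrt {p : ℝ} (hp : 0 < p) (x : ℝ) :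
    signedPow p (Real.sqrt x) = max x 0 ^ (p / 2) := by
  rw [signedPow_eq hp, max_eq_left (Real.sqrt_nonneg x), max_eq_right (by simp),
    Real.zero_rpow hp.ne', sub_zero]
  rcases le_total x 0 with h | h
  · rw [Real.sqrt_eq_zero_of_nonpos h, max_eq_right h, Real.zero_rpow hp.ne',
      Real.zero_rpow (by positivity)]
  · rw [max_eq_left h, Real.sqrt_eq_rpow, ← Real.rpow_mul h]
    congr 1; ring

lemma signedPow_sq {p : ℝ} (hp : 0 < p) (x : ℝ) : signedPow p x ^ 2 = |x| ^ (2 * p) := by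
  rcases eq_or_ne x 0 with rfl | h
  · simp [signedPow, Real.zero_rpow (show 2 * p ≠ 0 by positivity)]
  · have h1 : Real.sign x ^ 2 = 1 := by
      rcases Real.sign_apply_eq_of_ne_zero x h with h | h <;> rw [h] <;> norm_num
    rw [signedPow, mul_pow, h1, mul_one, mul_comm 2 p, Real.rpow_mul (abs_nonneg x), Real.rpow_two]

lemma abs_signedPow {p : ℝ} (hp : 0 < p) (x : ℝ) : |signedPow p x| = |x| ^ p := by
  rw [← sq_eq_sq₀ (abs_nonneg _) (by positivity), sq_abs, signedPow_sq hp, mul_comm 2 p,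
    Real.rpow_mul (abs_nonneg x), Real.rpow_two]

/-- The derivative `p t ^ (p - 1)` decreases in `t`, so on `(0, 2)` it is at least its value at `2`.
-/
lemma mul_sub_le_rpow_sub_rpow {p : ℝ} (hp : 0 < p) (hp1 : p < 1) {x y : ℝ} (hx : 0 ≤ x)
    (hxy : x ≤ y) (hy : y ≤ 2) : p * 2 ^ (p - 1) * (y - x) ≤ y ^ p - x ^ p := by
  refine (convex_Icc (0 : ℝ) 2).mul_sub_le_image_sub_of_le_deriv (f := fun x : ℝ => x ^ p)
    (Continuous.continuousOn (by exact Real.continuous_rpow_const hp.le)) ?_ ?_ x ⟨hx, hxy.trans hy⟩ y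
    ⟨hx.trans hxy, hy⟩ hxy
  · rw [interior_Icc]
    intro t ht
    exact (Real.differentiableAt_rpow_const_of_ne p ht.1.ne').differentiableWithinAt
  · rw [interior_Icc]
    intro t ht
    rw [Real.deriv_rpow_const]
    exact mul_le_mul_of_nonneg_left
      (Real.rpow_le_rpow_of_nonpos ht.1 ht.2.le (by linarith)) hp.le

lemma mul_sub_le_signedPow_sub {p : ℝ} (hp : 0 < p) (hp1 : p < 1) {x y : ℝ} (hx : -2 ≤ x)
    (hxy : x ≤ y) (hy : y ≤ 2) : p * 2 ^ (p - 1) * (y - x) ≤ signedPow p y - signedPow p x := by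
  have h1 := mul_sub_le_rpow_sub_rpow hp hp1 (le_max_right x 0) (max_le_max_right 0 hxy)
    (max_le hy two_pos.le)
  have h2 := mul_sub_le_rpow_sub_rpow hp hp1 (le_max_right (-y) 0)
    (max_le_max_right 0 (neg_le_neg hxy)) (max_le (by linarith) two_pos.le)
  have h3 : ∀ t : ℝ, max t 0 - max (-t) 0 = t := fun t => by
    rcases le_total t 0 with h | h
    · rw [max_eq_right h, max_eq_left (by linarith)]; ring
    · rw [max_eq_left h, max_eq_right (by linarith)]; ring
  rw [signedPow_eq hp, signedPow_eq hp]
  have h4 : y - x = (max y 0 - max x 0) + (max (-x) 0 - max (-y) 0) := by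
    linarith [h3 x, h3 y]
  rw [h4, mul_add]
  linarith

/-! ### Gaussian pairs and linear growth of `f p` -/

/-- The law of a pair of independent standard normal variables. -/
noncomputable def gaussPair : Measure (ℝ × ℝ) := (gaussianReal 0 1).prod (gaussianReal 0 1)

instance : IsProbabilityMeasure gaussPair := by unfold gaussPair; infer_instance

/-- Cholesky factorization, checked on characteristic functions. Writing the quadratic form as a sum
of two squares also gives positive semidefiniteness. -/
lemma multivariateGaussian_eq_map_gaussPair {S : Matrix (Fin 2) (Fin 2) ℝ} {a b r : ℝ}
    (hr : r ∈ Icc (-1 : ℝ) 1) (hS : S = !![a ^ 2, a * b * r; a * b * r, b ^ 2]) :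
    multivariateGaussian 0 S = gaussPair.map
      (fun z => !₂[a * z.1, b * (r * z.1 + Real.sqrt (1 - r ^ 2) * z.2)]) := by
  have hs : Real.sqrt (1 - r ^ 2) ^ 2 = 1 - r ^ 2 := Real.sq_sqrt (by nlinarith [hr.1, hr.2])
  set s := Real.sqrt (1 - r ^ 2)
  have hquad : ∀ x : Fin 2 → ℝ, x ⬝ᵥ S.mulVec x = (x 0 * a + x 1 * b * r) ^ 2 + (x 1 * b * s) ^ 2 :=
    fun x => by
      simp only [hS, Matrix.mulVec, dotProduct, Fin.sum_univ_two, Matrix.of_apply,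
        Matrix.cons_val_zero, Matrix.cons_val_one, Matrix.cons_val', Matrix.cons_val_fin_one]
      rw [mul_pow _ s, hs]; ring
  have hpos : S.PosSemidef := by
    refine Matrix.PosSemidef.of_dotProduct_mulVec_nonneg ?_ fun x => ?_
    · ext i j; fin_cases i <;> fin_cases j <;> simp [hS]
    · rw [star_trivial, hquad]; positivity
  have hmeas : Measurable (fun z : ℝ × ℝ =>
      (!₂[a * z.1, b * (r * z.1 + s * z.2)] : EuclideanSpace ℝ (Fin 2))) := by
    refine (WithLp.measurable_toLp 2 _).comp (measurable_pi_iff.2 fun i => ?_)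
    fin_cases i <;> simp <;> fun_prop
  have : IsProbabilityMeasure (gaussPair.map (fun z : ℝ × ℝ =>
      (!₂[a * z.1, b * (r * z.1 + s * z.2)] : EuclideanSpace ℝ (Fin 2)))) :=
    Measure.isProbabilityMeasure_map hmeas.aemeasurable
  refine Measure.ext_of_charFun (funext fun t => ?_)
  rw [charFun_multivariateGaussian hpos, charFun_apply,
    integral_map hmeas.aemeasurable (by fun_prop), hquad]
  have h1 : ∀ z : ℝ × ℝ, Complex.exp (((inner ℝ
      (!₂[a * z.1, b * (r * z.1 + s * z.2)] : EuclideanSpace ℝ (Fin 2)) t : ℝ) : ℂ) * Complex.I)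
      = Complex.exp (((t 0 * a + t 1 * b * r : ℝ) : ℂ) * z.1 * Complex.I) *
        Complex.exp (((t 1 * b * s : ℝ) : ℂ) * z.2 * Complex.I) := fun z => by
    rw [← Complex.exp_add]
    congr 1
    simp [PiLp.inner_apply, Fin.sum_univ_two]
    ring
  simp_rw [h1]
  rw [gaussPair, integral_prod_mul (fun x : ℝ => Complex.exp (((t 0 * a + t 1 * b * r : ℝ) : ℂ) *
    x * Complex.I)) (fun x : ℝ => Complex.exp (((t 1 * b * s : ℝ) : ℂ) * x * Complex.I)),
    ← charFun_apply_real, ← charFun_apply_real, charFun_gaussianReal, charFun_gaussianReal,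
    ← Complex.exp_add]
  congr 1
  simp
  ring

lemma integral_multivariateGaussian_prod {S : Matrix (Fin 2) (Fin 2) ℝ} {a b r : ℝ}
    (hr : r ∈ Icc (-1 : ℝ) 1) (hS : S = !![a ^ 2, a * b * r; a * b * r, b ^ 2])
    {φ : ℝ → ℝ} (hφ : Continuous φ) :
    ∫ z, φ (z 0 * z 1) ∂(multivariateGaussian 0 S)
      = ∫ z, φ (a * b * (z.1 * (r * z.1 + Real.sqrt (1 - r ^ 2) * z.2))) ∂gaussPair := by
  have hmeas : Measurable (fun z : ℝ × ℝ =>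
      (!₂[a * z.1, b * (r * z.1 + Real.sqrt (1 - r ^ 2) * z.2)] : EuclideanSpace ℝ (Fin 2))) := by
    refine (WithLp.measurable_toLp 2 _).comp (measurable_pi_iff.2 fun i => ?_)
    fin_cases i <;> simp <;> fun_prop
  rw [multivariateGaussian_eq_map_gaussPair hr hS, integral_map hmeas.aemeasurable]
  · congr 1; ext z; congr 1; simp; ring
  · exact (hφ.comp (by fun_prop)).aestronglyMeasurable

lemma f_eq_integral_gaussPair {p r : ℝ} (hp : 0 < p) (hr : r ∈ Icc (-1 : ℝ) 1) :
    f p r = ∫ z, signedPow p (z.1 * (r * z.1 + Real.sqrt (1 - r ^ 2) * z.2)) ∂gaussPair := by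
  rw [f, integral_multivariateGaussian_prod (a := 1) (b := 1) hr (by simp) (continuous_signedPow hp)]
  simp

lemma integral_signedPow_multivariateGaussian {S : Matrix (Fin 2) (Fin 2) ℝ} {p a b r : ℝ}
    (hp : 0 < p) (ha : 0 < a) (hb : 0 < b)
    (hr : r ∈ Icc (-1 : ℝ) 1) (hS : S = !![a ^ 2, a * b * r; a * b * r, b ^ 2]) :
    ∫ z, signedPow p (z 0 * z 1) ∂(multivariateGaussian 0 S) = (a * b) ^ p * f p r := by
  rw [integral_multivariateGaussian_prod hr hS (continuous_signedPow hp),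
    f_eq_integral_gaussPair hp hr, ← integral_const_mul]
  congr 1; ext z
  rw [signedPow_mul, signedPow_of_pos p (mul_pos ha hb)]

lemma integrable_abs_mul_rpow_multivariateGaussian (S : Matrix (Fin 2) (Fin 2) ℝ) {m : ℝ}
    (hm0 : 0 ≤ m) (hm : m ≤ 1) :
    Integrable (fun z : EuclideanSpace ℝ (Fin 2) => |z 0 * z 1| ^ m)
      (multivariateGaussian 0 S) := by
  have hL : ∀ i, MemLp (fun z : EuclideanSpace ℝ (Fin 2) => z i) 2 (multivariateGaussian 0 S) :=
    fun i => (EuclideanSpace.proj (𝕜 := ℝ) i).comp_memLp' IsGaussian.memLp_two_id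
  have hint := ((hL 0).integrable_mul (hL 1)).abs
  refine Integrable.mono' ((integrable_const 1).add hint) ?_ (ae_of_all _ fun z => ?_)
  · exact (Continuous.rpow_const (by fun_prop) fun _ => Or.inr hm0).aestronglyMeasurable
  · rw [Real.norm_of_nonneg (by positivity)]
    change _ ≤ 1 + |z 0 * z 1|
    rcases le_total |z 0 * z 1| 1 with h | h
    · exact (Real.rpow_le_one (abs_nonneg _) h hm0).trans (by linarith [abs_nonneg (z 0 * z 1)])
    · calc _ ≤ |z 0 * z 1| ^ (1 : ℝ) := Real.rpow_le_rpow_of_exponent_le h hm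
        _ ≤ _ := by rw [Real.rpow_one]; linarith

lemma integrable_signedPow_gaussPair {p r : ℝ} (hp : 0 < p) (hp1 : p ≤ 1)
    (hr : r ∈ Icc (-1 : ℝ) 1) :
    Integrable (fun z : ℝ × ℝ => signedPow p (z.1 * (r * z.1 + Real.sqrt (1 - r ^ 2) * z.2)))
      gaussPair := by
  have h := integrable_abs_mul_rpow_multivariateGaussian !![1, r; r, 1] hp.le hp1
  rw [multivariateGaussian_eq_map_gaussPair (a := 1) (b := 1) hr (by simp)] at h
  have hmeas : Measurable (fun z : ℝ × ℝ => (!₂[1 * z.1, 1 * (r * z.1 + Real.sqrt (1 - r ^ 2) * z.2)]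
      : EuclideanSpace ℝ (Fin 2))) := by
    refine (WithLp.measurable_toLp 2 _).comp (measurable_pi_iff.2 fun i => ?_)
    fin_cases i <;> simp <;> fun_prop
  refine Integrable.mono' (h.comp_measurable hmeas) ?_ (ae_of_all _ fun z => ?_)
  · exact ((continuous_signedPow hp).comp (by fun_prop)).aestronglyMeasurable
  · rw [Real.norm_eq_abs, abs_signedPow hp]; simp

lemma gaussPair_eq_withDensity : gaussPair = (volume : Measure (ℝ × ℝ)).withDensity
    (fun z => gaussianPDF 0 1 z.1 * gaussianPDF 0 1 z.2) := by
  rw [gaussPair, gaussianReal_of_var_ne_zero _ one_ne_zero,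
    prod_withDensity (by fun_prop) (by fun_prop), Measure.volume_eq_prod]

lemma toReal_gaussianPDF_mul (z : ℝ × ℝ) : (gaussianPDF 0 1 z.1 * gaussianPDF 0 1 z.2).toReal
    = (2 * Real.pi)⁻¹ * Real.exp (-(z.1 ^ 2 + z.2 ^ 2) / 2) := by
  rw [ENNReal.toReal_mul, toReal_gaussianPDF, toReal_gaussianPDF, gaussianPDFReal, gaussianPDFReal]
  have h3 : (Real.sqrt (2 * Real.pi))⁻¹ * (Real.sqrt (2 * Real.pi))⁻¹ = (2 * Real.pi)⁻¹ := by
    rw [← mul_inv, Real.mul_self_sqrt (by positivity)]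
  simp only [NNReal.coe_one, mul_one, sub_zero]
  rw [mul_mul_mul_comm, h3, ← Real.exp_add]
  congr 2; ring

lemma gaussianPDF_mul_lt_top (z : ℝ × ℝ) : gaussianPDF 0 1 z.1 * gaussianPDF 0 1 z.2 < ⊤ :=
  ENNReal.mul_lt_top gaussianPDF_lt_top gaussianPDF_lt_top

lemma integral_gaussPair (k : ℝ × ℝ → ℝ) :
    ∫ z, k z ∂gaussPair
      = (2 * Real.pi)⁻¹ * ∫ z : ℝ × ℝ, Real.exp (-(z.1 ^ 2 + z.2 ^ 2) / 2) * k z := by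
  rw [gaussPair_eq_withDensity, integral_withDensity_eq_integral_toReal_smul (by fun_prop)
    (ae_of_all _ gaussianPDF_mul_lt_top), ← integral_const_mul]
  congr 1; ext z
  rw [toReal_gaussianPDF_mul, smul_eq_mul, mul_assoc]

lemma integrable_exp_mul_of_gaussPair {k : ℝ × ℝ → ℝ} (hk : Integrable k gaussPair) :
    Integrable (fun z : ℝ × ℝ => Real.exp (-(z.1 ^ 2 + z.2 ^ 2) / 2) * k z) := by
  rw [gaussPair_eq_withDensity, integrable_withDensity_iff_integrable_smul' (by fun_prop)
    (ae_of_all _ gaussianPDF_mul_lt_top)] at hk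
  refine (hk.const_mul (2 * Real.pi)).congr (ae_of_all _ fun z => ?_)
  have := Real.pi_pos
  simp only
  rw [toReal_gaussianPDF_mul, smul_eq_mul]
  field_simp

/-- The map `θ ↦ 2 θ - γ` runs through two full periods, with Jacobian factor one half. -/
lemma integral_comp_two_mul_sub_of_periodic {k : ℝ → ℝ} (hk : Function.Periodic k (2 * Real.pi))
    (hc : Continuous k) (γ : ℝ) :
    ∫ θ in (-Real.pi)..Real.pi, k (2 * θ - γ) = ∫ θ in (-Real.pi)..Real.pi, k θ := by
  have h0 : ∀ t, ∫ θ in t..(t + 2 * Real.pi), k θ = ∫ θ in (-Real.pi)..Real.pi, k θ := fun t => by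
    rw [hk.intervalIntegral_add_eq t (-Real.pi)]
    congr 1; ring
  rw [intervalIntegral.integral_comp_mul_sub _ two_ne_zero,
    ← intervalIntegral.integral_add_adjacent_intervals (b := 2 * -Real.pi - γ + 2 * Real.pi)
      (hc.intervalIntegrable _ _) (hc.intervalIntegrable _ _), h0,
    show 2 * Real.pi - γ = 2 * -Real.pi - γ + 2 * Real.pi + 2 * Real.pi by ring, h0, smul_eq_mul]
  ring

/-- With `r = cos γ`, the pair is `R cos θ`, `R cos (θ - γ)`, whose product is `(R ^ 2 / 2) * (r +
cos (2 θ - γ))`. The radial part separates and becomes the constant. -/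
lemma exists_f_eq_mul_intervalIntegral {p : ℝ} (hp : 0 < p) :
    ∃ C : ℝ, 0 < C ∧ ∀ r ∈ Icc (-1 : ℝ) 1,
      f p r = C * ∫ θ in (-Real.pi)..Real.pi, signedPow p (r + Real.cos θ) := by
  refine ⟨(2 * Real.pi)⁻¹ * ∫ R in Ioi (0 : ℝ),
    R * (Real.exp (-R ^ 2 / 2) * (R ^ 2 / 2) ^ p), ?_, fun r hr => ?_⟩
  -- The Gamma evaluation serves only to show that the radial constant is strictly positive.
  · have h := integral_rpow_mul_exp_neg_mul_rpow (p := 2) (q := 1 + 2 * p) (b := 1 / 2) two_pos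
      (by linarith) (by norm_num)
    have h2 : ∫ R in Ioi (0 : ℝ), R * (Real.exp (-R ^ 2 / 2) * (R ^ 2 / 2) ^ p)
        = 2⁻¹ ^ p * ∫ R in Ioi (0 : ℝ), R ^ (1 + 2 * p) * Real.exp (-(1 / 2) * R ^ (2 : ℝ)) := by
      rw [← integral_const_mul]
      refine setIntegral_congr_fun measurableSet_Ioi fun R hR => ?_
      have h0 : (0 : ℝ) < R := hR
      rw [Real.rpow_add h0, Real.rpow_one, Real.rpow_mul h0.le, Real.rpow_two,
        div_eq_mul_inv (R ^ 2) 2, Real.mul_rpow (by positivity) (by positivity)]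
      ring_nf
    rw [h2, h]
    have := Real.pi_pos
    have hG : 0 < Real.Gamma ((1 + 2 * p + 1) / 2) := Real.Gamma_pos_of_pos (by positivity)
    positivity
  · set γ := Real.arccos r
    have hcos : Real.cos γ = r := Real.cos_arccos hr.1 hr.2
    have hsin : Real.sin γ = Real.sqrt (1 - r ^ 2) := Real.sin_arccos r
    have hpi : -Real.pi ≤ Real.pi := by linarith [Real.pi_pos]
    rw [f_eq_integral_gaussPair hp hr, integral_gaussPair, ← integral_comp_polarCoord_symm,
      polarCoord_target, mul_assoc]
    congr 1
    rw [← integral_comp_two_mul_sub_of_periodic (k := fun θ => signedPow p (r + Real.cos θ))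
      (fun θ => by simp only [Real.cos_add_two_pi])
      ((continuous_signedPow hp).comp (by fun_prop)) γ,
      intervalIntegral.integral_of_le hpi, integral_Ioc_eq_integral_Ioo, Measure.volume_eq_prod,
      ← setIntegral_prod_mul]
    refine setIntegral_congr_fun (measurableSet_Ioi.prod measurableSet_Ioo) fun z hz => ?_
    have h0 : (0 : ℝ) < z.1 := hz.1
    have h1 : (z.1 * Real.cos z.2) ^ 2 + (z.1 * Real.sin z.2) ^ 2 = z.1 ^ 2 := by
      rw [mul_pow, mul_pow, ← mul_add, Real.cos_sq_add_sin_sq, mul_one]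
    have h2 : z.1 * Real.cos z.2 * (r * (z.1 * Real.cos z.2)
        + Real.sqrt (1 - r ^ 2) * (z.1 * Real.sin z.2))
        = (z.1 ^ 2 / 2) * (r + Real.cos (2 * z.2 - γ)) := by
      rw [← hsin, ← hcos, Real.cos_sub, Real.cos_two_mul, Real.sin_two_mul]; ring
    simp only [polarCoord_symm_apply, smul_eq_mul]
    rw [h1, h2, signedPow_mul, signedPow_of_pos p (by positivity)]
    ring

/-- `f_p` grows at least linearly. -/
lemma exists_mul_sub_le_f_sub {p : ℝ} (hp : 0 < p) (hp1 : p < 1) :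
    ∃ c : ℝ, 0 < c ∧ ∀ r ∈ Icc (-1 : ℝ) 1, ∀ r' ∈ Icc (-1 : ℝ) 1, r ≤ r' →
      c * (r' - r) ≤ f p r' - f p r := by
  obtain ⟨C, hC, h⟩ := exists_f_eq_mul_intervalIntegral hp
  have hpi := Real.pi_pos
  refine ⟨C * (2 * Real.pi * (p * 2 ^ (p - 1))), by positivity, fun r hr r' hr' hrr => ?_⟩
  have hi : ∀ r : ℝ, IntervalIntegrable (fun θ => signedPow p (r + Real.cos θ)) volume
      (-Real.pi) Real.pi := fun r =>
    ((continuous_signedPow hp).comp (by fun_prop)).intervalIntegrable _ _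
  rw [h r hr, h r' hr', ← mul_sub, ← intervalIntegral.integral_sub (hi r') (hi r), mul_assoc]
  refine mul_le_mul_of_nonneg_left ?_ hC.le
  have h1 : ∫ _θ in (-Real.pi)..Real.pi, p * 2 ^ (p - 1) * (r' - r)
      = 2 * Real.pi * (p * 2 ^ (p - 1)) * (r' - r) := by
    rw [intervalIntegral.integral_const, smul_eq_mul]; ring
  rw [← h1]
  refine intervalIntegral.integral_mono_on (by linarith) (by simp) ((hi r').sub (hi r))
    fun θ _ => ?_
  have h2 := Real.neg_one_le_cos θ
  have h3 := Real.cos_le_one θ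
  have := mul_sub_le_signedPow_sub hp hp1 (x := r + Real.cos θ) (y := r' + Real.cos θ)
    (by linarith [hr.1]) (by linarith) (by linarith [hr'.2])
  rwa [add_sub_add_right_eq_sub] at this

/-! ### Differentiability of `f p` -/

/-- The signed moment generating function of the product of two independent standard normal
variables (up to the constant `2π`). -/
noncomputable def signedMGF (p r : ℝ) : ℝ :=
  ∫ z : ℝ × ℝ, signedPow p z.1 * signedPow p z.2
    * Real.exp (-(z.1 ^ 2 + z.2 ^ 2) / 2 + r * (z.1 * z.2))

lemma integrable_abs_rpow_mul_exp {m b : ℝ} (hm : 0 ≤ m) (hb : 0 < b) :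
    Integrable (fun x : ℝ => |x| ^ m * Real.exp (-b * x ^ 2)) := by
  have h := (integrable_rpow_mul_exp_neg_mul_sq hb (s := m) (by linarith)).norm
  -- `x ^ m` is not `|x| ^ m` for negative `x`; adding the reflected function gives a majorant on
  -- both half-lines.
  have h2 := (integrable_rpow_mul_exp_neg_mul_sq hb (s := m) (by linarith)).comp_neg.norm
  refine Integrable.mono' (h.add h2) ?_ (ae_of_all _ fun x => ?_)
  · exact (Continuous.mul (Continuous.rpow_const (by fun_prop) fun _ => Or.inr hm)
      (by fun_prop)).aestronglyMeasurable
  · rw [Real.norm_of_nonneg (by positivity)]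
    simp only [Pi.add_apply, norm_mul, Real.norm_eq_abs, Real.abs_exp, neg_sq]
    rw [← add_mul]
    gcongr
    rcases le_total x 0 with h | h
    · rw [abs_of_nonpos h, abs_of_nonneg (a := (-x) ^ m) (Real.rpow_nonneg (by linarith) _)]
      linarith [abs_nonneg (x ^ m)]
    · rw [abs_of_nonneg h, abs_of_nonneg (a := x ^ m) (by positivity)]
      linarith [abs_nonneg ((-x) ^ m)]

lemma exp_quadratic_le {R r : ℝ} (hr : |r| ≤ R) (x y : ℝ) :
    Real.exp (-(x ^ 2 + y ^ 2) / 2 + r * (x * y))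
      ≤ Real.exp (-((1 - R) / 2) * x ^ 2) * Real.exp (-((1 - R) / 2) * y ^ 2) := by
  rw [← Real.exp_add, Real.exp_le_exp]
  have h1 : r * (x * y) ≤ R * |x * y| := by
    calc r * (x * y) ≤ |r * (x * y)| := le_abs_self _
      _ = |r| * |x * y| := abs_mul _ _
      _ ≤ _ := by gcongr
  have h2 : |x * y| ≤ (x ^ 2 + y ^ 2) / 2 := by
    rw [abs_mul, ← sq_abs x, ← sq_abs y]; nlinarith [sq_nonneg (|x| - |y|)]
  have h3 : R * |x * y| ≤ R * ((x ^ 2 + y ^ 2) / 2) :=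
    mul_le_mul_of_nonneg_left h2 ((abs_nonneg r).trans hr)
  linarith

lemma integrable_signedMGF_bound {m R : ℝ} (hm : 0 ≤ m) (hR : R < 1) :
    Integrable (fun z : ℝ × ℝ => |z.1| ^ m * |z.2| ^ m *
      (Real.exp (-((1 - R) / 2) * z.1 ^ 2) * Real.exp (-((1 - R) / 2) * z.2 ^ 2))) := by
  have h := integrable_abs_rpow_mul_exp hm (show 0 < (1 - R) / 2 by linarith)
  refine (h.mul_prod h).congr (ae_of_all _ fun z => ?_)
  simp only; ring

lemma integrable_signedMGF {p r : ℝ} (hp : 0 < p) (hr : |r| < 1) :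
    Integrable (fun z : ℝ × ℝ => signedPow p z.1 * signedPow p z.2
      * Real.exp (-(z.1 ^ 2 + z.2 ^ 2) / 2 + r * (z.1 * z.2))) := by
  refine Integrable.mono' (integrable_signedMGF_bound hp.le hr) ?_ (ae_of_all _ fun z => ?_)
  · have := continuous_signedPow hp
    exact Continuous.aestronglyMeasurable (by fun_prop)
  · rw [norm_mul, norm_mul, Real.norm_eq_abs, Real.norm_eq_abs, abs_signedPow hp,
      abs_signedPow hp, Real.norm_of_nonneg (Real.exp_pos _).le]
    gcongr
    exact exp_quadratic_le le_rfl _ _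

lemma differentiableAt_signedMGF {p r : ℝ} (hp : 0 < p) (hr : |r| < 1) :
    DifferentiableAt ℝ (signedMGF p) r := by
  obtain ⟨R, hrR, hR⟩ := exists_between hr
  have hU : {t : ℝ | |t| < R} ∈ 𝓝 r :=
    (isOpen_lt continuous_abs continuous_const).mem_nhds hrR
  have hsp := continuous_signedPow hp
  refine (hasDerivAt_integral_of_dominated_loc_of_deriv_le (μ := volume)
    (F := fun t (z : ℝ × ℝ) => signedPow p z.1 * signedPow p z.2
      * Real.exp (-(z.1 ^ 2 + z.2 ^ 2) / 2 + t * (z.1 * z.2)))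
    (F' := fun t (z : ℝ × ℝ) => signedPow p z.1 * signedPow p z.2
      * (Real.exp (-(z.1 ^ 2 + z.2 ^ 2) / 2 + t * (z.1 * z.2)) * (z.1 * z.2))) hU ?_
    (integrable_signedMGF hp hr) ?_ ?_
    (integrable_signedMGF_bound (m := p + 1) (by linarith) hR) ?_).2.differentiableAt
  · exact Eventually.of_forall fun t => Continuous.aestronglyMeasurable (by fun_prop)
  · exact Continuous.aestronglyMeasurable (by fun_prop)
  · refine ae_of_all _ fun z t ht => ?_
    rw [norm_mul, norm_mul, norm_mul, Real.norm_eq_abs, Real.norm_eq_abs, abs_signedPow hp,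
      abs_signedPow hp, Real.norm_of_nonneg (Real.exp_pos _).le, Real.norm_eq_abs, abs_mul,
      Real.rpow_add_one' (abs_nonneg _) (by linarith),
      Real.rpow_add_one' (abs_nonneg _) (by linarith)]
    have h1 := exp_quadratic_le (le_of_lt ht) z.1 z.2
    calc _ = |z.1| ^ p * |z.1| * (|z.2| ^ p * |z.2|) *
          Real.exp (-(z.1 ^ 2 + z.2 ^ 2) / 2 + t * (z.1 * z.2)) := by ring
      _ ≤ _ := by gcongr
  · refine ae_of_all _ fun z t _ => ?_
    have h1 : HasDerivAt (fun t : ℝ => -(z.1 ^ 2 + z.2 ^ 2) / 2 + t * (z.1 * z.2))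
        (z.1 * z.2) t := by
      simpa using ((hasDerivAt_id t).mul_const (z.1 * z.2)).const_add (-(z.1 ^ 2 + z.2 ^ 2) / 2)
    exact h1.exp.const_mul _

/-- With `s = √(1 - r²)`, replacing `x` by `s x` and then `y` by `y - r x` turns the argument of the
signed power into `s² x y` and the exponent into `-(x² + y²) / 2 + r x y`. The Jacobian `s` and the
factor `s ^ (2 p)` make up the prefactor. -/
lemma f_eq_mul_signedMGF {p r : ℝ} (hp : 0 < p) (hp1 : p ≤ 1) (hr : |r| < 1) :
    f p r = (2 * Real.pi)⁻¹ * ((1 - r ^ 2) ^ (p + 1 / 2) * signedMGF p r) := by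
  have hr' := abs_lt.1 hr
  have hrI : r ∈ Icc (-1 : ℝ) 1 := ⟨hr'.1.le, hr'.2.le⟩
  have hs2 : 0 < 1 - r ^ 2 := by nlinarith
  have hs : 0 < Real.sqrt (1 - r ^ 2) := Real.sqrt_pos.2 hs2
  have hss : Real.sqrt (1 - r ^ 2) ^ 2 = 1 - r ^ 2 := Real.sq_sqrt hs2.le
  have hspow : (1 - r ^ 2) ^ (p + 1 / 2) = Real.sqrt (1 - r ^ 2) *
      (Real.sqrt (1 - r ^ 2) ^ p * Real.sqrt (1 - r ^ 2) ^ p) := by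
    rw [Real.sqrt_eq_rpow, ← Real.rpow_mul hs2.le, ← Real.rpow_add hs2, ← Real.rpow_add hs2]
    congr 1; ring
  have hfi := integrable_signedPow_gaussPair hp hp1 hrI
  set s := Real.sqrt (1 - r ^ 2) with hsdef
  have hint : Integrable (fun z : ℝ × ℝ => Real.exp (-(z.1 ^ 2 + z.2 ^ 2) / 2) *
      signedPow p (z.1 * (r * z.1 + s * z.2))) := integrable_exp_mul_of_gaussPair hfi
  rw [f_eq_integral_gaussPair hp hrI, integral_gaussPair, hspow]
  congr 1
  rw [Measure.volume_eq_prod] at hint ⊢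
  rw [integral_prod _ hint]
  have hscale : ∀ k : ℝ → ℝ, ∫ x, k x = s * ∫ x, k (s * x) := fun k => by
    rw [Measure.integral_comp_mul_left, abs_of_pos (inv_pos.2 hs), smul_eq_mul, ← mul_assoc,
      mul_inv_cancel₀ hs.ne', one_mul]
  rw [hscale, mul_assoc]
  congr 1
  rw [signedMGF, Measure.volume_eq_prod, integral_prod _ (integrable_signedMGF hp hr),
    ← integral_const_mul]
  congr 1; ext x
  rw [← integral_sub_right_eq_self _ (r * x), ← integral_const_mul]
  congr 1; ext y
  simp only
  rw [show s * x * (r * (s * x) + s * (y - r * x)) = s * (s * (x * y)) by ring, signedPow_mul,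
    signedPow_mul, signedPow_mul, signedPow_of_pos p hs, mul_pow, hss,
    show -((1 - r ^ 2) * x ^ 2 + (y - r * x) ^ 2) / 2 = -(x ^ 2 + y ^ 2) / 2 + r * (x * y) by ring]
  ring

lemma differentiableAt_f {p r : ℝ} (hp : 0 < p) (hp1 : p ≤ 1) (hr : r ∈ Ioo (-1 : ℝ) 1) :
    DifferentiableAt ℝ (f p) r := by
  have h1 : DifferentiableAt ℝ
      (fun r => (2 * Real.pi)⁻¹ * ((1 - r ^ 2) ^ (p + 1 / 2) * signedMGF p r)) r := by
    refine (DifferentiableAt.mul ?_ (differentiableAt_signedMGF hp (abs_lt.2 hr))).const_mul _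
    exact DifferentiableAt.rpow_const (by fun_prop) (Or.inl (by nlinarith [hr.1, hr.2]))
  refine h1.congr_of_eventuallyEq ?_
  filter_upwards [isOpen_Ioo.mem_nhds hr] with t ht
  exact f_eq_mul_signedMGF hp hp1 (abs_lt.2 ht)

/-! ### Moments of `g` under the model -/

section ModelMoments

variable {Ω : Type*} {α σ : Fin 2 → ℝ} {q p : ℝ}
  {A : Fin 2 → Ω → ℝ} {G : Ω → EuclideanSpace ℝ (Fin 2)}

lemma continuous_g (α σ : Fin 2 → ℝ) (hp : 0 < p) : Continuous (g α σ p) := by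
  have := continuous_signedPow hp
  unfold g
  fun_prop

lemma g_modelVector (hp : 0 < p) (ω : Ω) :
    g α σ p (modelVector A G ω) = (max (A 0 ω) 0 ^ (p / 2) * max (A 1 ω) 0 ^ (p / 2))
      * signedPow p (G ω 0 * G ω 1)
      / (2 ^ p * σ 0 ^ p * σ 1 ^ p * momentConst (α 0) p * momentConst (α 1) p) := by
  simp only [g, modelVector, signedPow_mul, signedPow_sqrt hp]
  ring

lemma g_modelVector_sq (hp : 0 < p) (ω : Ω) :
    g α σ p (modelVector A G ω) ^ 2 = (max (A 0 ω) 0 ^ p * max (A 1 ω) 0 ^ p)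
      * |G ω 0 * G ω 1| ^ (2 * p)
      / (2 ^ p * σ 0 ^ p * σ 1 ^ p * momentConst (α 0) p * momentConst (α 1) p) ^ 2 := by
  have h : ∀ x : ℝ, (max x 0 ^ (p / 2)) ^ 2 = max x 0 ^ p := fun x => by
    rw [← Real.rpow_two, ← Real.rpow_mul (le_max_right _ _)]; congr 1; ring
  rw [g_modelVector hp, div_pow, mul_pow, mul_pow, h, h, signedPow_sq hp]

variable [MeasurableSpace Ω] {P : Measure Ω}

lemma IsModel.indepFun_max_rpow {Q : Matrix (Fin 2) (Fin 2) ℝ} (h : IsModel P α Q A G) (s : ℝ) :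
    IndepFun (fun ω => max (A 0 ω) 0 ^ s) (fun ω => max (A 1 ω) 0 ^ s) P :=
  (h.indep_A.indepFun (i := 0) (j := 1) (by decide)).comp (φ := fun x : ℝ => max x 0 ^ s)
    (ψ := fun x : ℝ => max x 0 ^ s) (by fun_prop) (by fun_prop)

lemma IsModel.indepFun_max_rpow_mul {Q : Matrix (Fin 2) (Fin 2) ℝ} (h : IsModel P α Q A G)
    (s : ℝ) {k : ℝ → ℝ} (hk : Measurable k) :
    IndepFun (fun ω => max (A 0 ω) 0 ^ s * max (A 1 ω) 0 ^ s) (fun ω => k (G ω 0 * G ω 1)) P :=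
  h.indep_A_G.comp (φ := fun x : Fin 2 → ℝ => max (x 0) 0 ^ s * max (x 1) 0 ^ s)
    (ψ := fun z : EuclideanSpace ℝ (Fin 2) => k (z 0 * z 1)) (by fun_prop)
    (hk.comp (by fun_prop))

lemma IsModel.integrable_max_rpow {Q : Matrix (Fin 2) (Fin 2) ℝ} (h : IsModel P α Q A G)
    {i : Fin 2} (hα : α i ∈ Ioo (1 : ℝ) 2) {s : ℝ} (hs : s ∈ Ioo 0 (α i / 2)) :
    Integrable (fun ω => max (A i ω) 0 ^ s) P :=
  ((h.law_A i).integrable_max_rpow hα hs).comp_aemeasurable (h.aemeasurable_A i)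

lemma IsModel.integrable_max_rpow_mul {Q : Matrix (Fin 2) (Fin 2) ℝ} (h : IsModel P α Q A G)
    (hα : ∀ i, α i ∈ Ioo (1 : ℝ) 2) {s : ℝ} (hs : ∀ i, s ∈ Ioo 0 (α i / 2)) :
    Integrable (fun ω => max (A 0 ω) 0 ^ s * max (A 1 ω) 0 ^ s) P :=
  (h.indepFun_max_rpow s).integrable_mul (h.integrable_max_rpow (hα 0) (hs 0))
    (h.integrable_max_rpow (hα 1) (hs 1))

lemma IsModel.aestronglyMeasurable_modelVector {Q : Matrix (Fin 2) (Fin 2) ℝ}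
    (h : IsModel P α Q A G) (hp : 0 < p) :
    AEStronglyMeasurable (fun ω => g α σ p (modelVector A G ω)) P := by
  refine ((continuous_g α σ hp).measurable.comp_aemeasurable ?_).aestronglyMeasurable
  refine aemeasurable_pi_iff.2 fun i => ?_
  have h1 := h.aemeasurable_A i
  have h2 : AEMeasurable (fun ω => G ω i) P :=
    (EuclideanSpace.proj (𝕜 := ℝ) i).continuous.measurable.comp_aemeasurable h.law_G.aemeasurable
  exact h1.sqrt.mul h2

/-- Squaring requires moments of order `p < α i / 2` of the `A i` and of order `2 p ≤ 1` of the
Gaussian product. -/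
lemma IsModel.integrable_g_sq {Q : Matrix (Fin 2) (Fin 2) ℝ} (h : IsModel P α Q A G)
    (hα : ∀ i, α i ∈ Ioo (1 : ℝ) 2) (hp : 0 < p) (hpα : ∀ i, p < α i / 4) :
    Integrable (fun ω => g α σ p (modelVector A G ω) ^ 2) P := by
  simp_rw [g_modelVector_sq hp]
  refine Integrable.div_const ?_ _
  have hp2 : 2 * p ≤ 1 := by linarith [hpα 0, (hα 0).2]
  refine (h.indepFun_max_rpow_mul p (k := fun x => |x| ^ (2 * p)) (by fun_prop)).integrable_mul
    (h.integrable_max_rpow_mul hα fun i => ⟨hp, by linarith [hpα i]⟩) ?_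
  have h2 := integrable_abs_mul_rpow_multivariateGaussian Q (show 0 ≤ 2 * p by positivity) hp2
  rw [← h.law_G.map_eq] at h2
  exact h2.comp_aemeasurable h.law_G.aemeasurable

lemma IsModel.integral_g (h : IsModel P α (covMat σ q) A G)
    (hα : ∀ i, α i ∈ Ioo (1 : ℝ) 2) (hσ : ∀ i, 0 < σ i) (hq : q ∈ Icc (-1 : ℝ) 1)
    (hp : 0 < p) (hpα : ∀ i, p < α i / 4) :
    ∫ ω, g α σ p (modelVector A G ω) ∂P = f p q := by
  have hsp := continuous_signedPow hp
  have hA : ∀ i, ∫ ω, max (A i ω) 0 ^ (p / 2) ∂P = momentConst (α i) p := fun i => by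
    rw [← (h.law_A i).integral_max_rpow (hα i) hp (hpα i), integral_map (h.aemeasurable_A i)]
    exact Measurable.aestronglyMeasurable (by fun_prop)
  have hG : ∫ ω, signedPow p (G ω 0 * G ω 1) ∂P = (2 * σ 0 * σ 1) ^ p * f p q := by
    have h2 : Real.sqrt 2 * Real.sqrt 2 = 2 := Real.mul_self_sqrt two_pos.le
    have h3 := integral_signedPow_multivariateGaussian (S := covMat σ q)
      (a := Real.sqrt 2 * σ 0) (b := Real.sqrt 2 * σ 1) hp
      (mul_pos (by positivity) (hσ 0)) (mul_pos (by positivity) (hσ 1)) hq (by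
        rw [covMat, mul_pow, mul_pow, Real.sq_sqrt two_pos.le,
          show Real.sqrt 2 * σ 0 * (Real.sqrt 2 * σ 1) * q = 2 * σ 0 * σ 1 * q by
            linear_combination (σ 0 * σ 1 * q) * h2])
    rw [show Real.sqrt 2 * σ 0 * (Real.sqrt 2 * σ 1) = 2 * σ 0 * σ 1 by
      linear_combination (σ 0 * σ 1) * h2] at h3
    have h4 : Continuous fun z : EuclideanSpace ℝ (Fin 2) => signedPow p (z 0 * z 1) :=
      hsp.comp (by fun_prop)
    rw [← h3]
    exact h.law_G.integral_comp h4.aestronglyMeasurable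
  have hs : ∀ i, p / 2 ∈ Ioo 0 (α i / 2) := fun i => ⟨by positivity, by linarith [hpα i, (hα i).1]⟩
  have hm : ∀ i, AEStronglyMeasurable (fun ω => max (A i ω) 0 ^ (p / 2)) P := fun i =>
    (h.integrable_max_rpow (hα i) (hs i)).aestronglyMeasurable
  have hGm : AEStronglyMeasurable (fun ω => signedPow p (G ω 0 * G ω 1)) P := by
    have h1 : Continuous fun z : EuclideanSpace ℝ (Fin 2) => signedPow p (z 0 * z 1) :=
      hsp.comp (by fun_prop)
    exact (h1.measurable.comp_aemeasurable h.law_G.aemeasurable).aestronglyMeasurable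
  simp_rw [g_modelVector hp]
  rw [integral_div, (h.indepFun_max_rpow_mul (p / 2) hsp.measurable).integral_fun_mul_eq_mul_integral
    ((hm 0).mul (hm 1)) hGm, (h.indepFun_max_rpow (p / 2)).integral_fun_mul_eq_mul_integral
    (hm 0) (hm 1), hA, hA, hG]
  have h0 := momentConst_pos (hα 0) hp (hpα 0)
  have h1 := momentConst_pos (hα 1) hp (hpα 1)
  have hσ0 := hσ 0
  have hσ1 := hσ 1
  rw [Real.mul_rpow (by positivity) hσ1.le, Real.mul_rpow two_pos.le hσ0.le]
  field_simp

end ModelMoments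

/-! ### The inverse of `f p` -/

section Inverse

variable {p : ℝ}

lemma injOn_f (hp : 0 < p) (hp1 : p < 1) : InjOn (f p) (Icc (-1) 1) := by
  obtain ⟨c, hc, h⟩ := exists_mul_sub_le_f_sub hp hp1
  intro x hx y hy hxy
  rcases le_total x y with hl | hl
  · have := h x hx y hy hl
    rw [hxy, sub_self] at this
    nlinarith
  · have := h y hy x hx hl
    rw [hxy, sub_self] at this
    nlinarith

lemma deriv_f_pos (hp : 0 < p) (hp1 : p < 1) {q : ℝ} (hq : q ∈ Ioo (-1 : ℝ) 1) :
    0 < deriv (f p) q := by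
  obtain ⟨c, hc, h⟩ := exists_mul_sub_le_f_sub hp hp1
  refine hc.trans_le ?_
  have hd := hasDerivAt_iff_tendsto_slope.1 (differentiableAt_f hp hp1.le hq).hasDerivAt
  refine ge_of_tendsto hd ?_
  filter_upwards [self_mem_nhdsWithin, mem_nhdsWithin_of_mem_nhds (isOpen_Ioo.mem_nhds hq)]
    with t ht ht'
  have htI := Ioo_subset_Icc_self ht'
  have hqI := Ioo_subset_Icc_self hq
  rw [slope_def_field]
  rcases lt_or_gt_of_ne ht with hl | hl
  · rw [← neg_div_neg_eq, le_div_iff₀ (by linarith)]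
    linarith [h t htI q hqI hl.le]
  · rw [le_div_iff₀ (sub_pos.2 hl)]
    exact h q hqI t htI hl.le

lemma fInv_of_mem {ext : ℝ → ℝ} {y : ℝ} (hy : y ∈ f p '' Ioo (-1) 1) :
    fInv p ext y ∈ Ioo (-1 : ℝ) 1 ∧ f p (fInv p ext y) = y := by
  rw [fInv, if_pos hy]
  exact ⟨Function.invFunOn_mem hy, Function.invFunOn_eq hy⟩

lemma fInv_f (hp : 0 < p) (hp1 : p < 1) (ext : ℝ → ℝ) {r : ℝ} (hr : r ∈ Ioo (-1 : ℝ) 1) :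
    fInv p ext (f p r) = r := by
  have h := fInv_of_mem (p := p) (ext := ext) (mem_image_of_mem (f p) hr)
  exact injOn_f hp hp1 (Ioo_subset_Icc_self h.1) (Ioo_subset_Icc_self hr) h.2

lemma continuousOn_f (hp : 0 < p) (hp1 : p < 1) : ContinuousOn (f p) (Ioo (-1) 1) :=
  fun _ hr => (differentiableAt_f hp hp1.le hr).continuousAt.continuousWithinAt

/-- On the range, a sublevel set is the continuous image of an interval, hence order-connected and
Borel. -/
lemma measurable_fInv (hp : 0 < p) (hp1 : p < 1) {ext : ℝ → ℝ} (hext : Measurable ext) :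
    Measurable (fInv p ext) := by
  have hS : ∀ c, MeasurableSet (f p '' (Ioo (-1) 1 ∩ Iic c)) := fun c => by
    have h : (Ioo (-1 : ℝ) 1 ∩ Iic c).OrdConnected := ordConnected_Ioo.inter ordConnected_Iic
    exact (h.isPreconnected.image _
      ((continuousOn_f hp hp1).mono inter_subset_left)).ordConnected.measurableSet
  have hS1 : MeasurableSet (f p '' Ioo (-1) 1) :=
    (isPreconnected_Ioo.image _ (continuousOn_f hp hp1)).ordConnected.measurableSet
  refine measurable_of_Iic fun c => ?_
  have h : fInv p ext ⁻¹' Iic c = f p '' (Ioo (-1) 1 ∩ Iic c)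
      ∪ ((f p '' Ioo (-1) 1)ᶜ ∩ ext ⁻¹' Iic c) := by
    ext y
    by_cases hy : y ∈ f p '' Ioo (-1) 1
    · have h1 := fInv_of_mem (ext := ext) hy
      simp only [mem_preimage, mem_union, mem_inter_iff, mem_compl_iff, hy, not_true, false_and,
        or_false]
      constructor
      · exact fun h2 => ⟨_, ⟨h1.1, h2⟩, h1.2⟩
      · rintro ⟨r, ⟨hr, hrc⟩, rfl⟩
        rwa [fInv_f hp hp1 ext hr]
    · have h2 : y ∉ f p '' (Ioo (-1) 1 ∩ Iic c) := fun h => hy (image_mono inter_subset_left h)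
      simp only [mem_preimage, mem_union, mem_inter_iff, mem_compl_iff, hy, h2, not_false_eq_true,
        true_and, false_or]
      rw [fInv, if_neg hy]
  rw [h]
  exact (hS c).union (hS1.compl.inter (hext measurableSet_Iic))

lemma image_f_mem_nhds (hp : 0 < p) (hp1 : p < 1) {q : ℝ} (hq : q ∈ Ioo (-1 : ℝ) 1) :
    f p '' Ioo (-1) 1 ∈ 𝓝 (f p q) := by
  obtain ⟨c, hc, h⟩ := exists_mul_sub_le_f_sub hp hp1
  obtain ⟨a, ha, haq⟩ := exists_between hq.1
  obtain ⟨b, hqb, hb⟩ := exists_between hq.2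
  have hab : Icc a b ⊆ Ioo (-1 : ℝ) 1 := fun x hx => ⟨ha.trans_le hx.1, hx.2.trans_lt hb⟩
  have hmem : ∀ x ∈ Icc a b, x ∈ Icc (-1 : ℝ) 1 := fun x hx => Ioo_subset_Icc_self (hab hx)
  have hqI := Ioo_subset_Icc_self hq
  have hle : a ≤ b := (haq.trans hqb).le
  have h1 := h a (hmem a ⟨le_rfl, hle⟩) q hqI haq.le
  have h2 := h q hqI b (hmem b ⟨hle, le_rfl⟩) hqb.le
  refine mem_of_superset (Icc_mem_nhds (a := f p a) (b := f p b) (by nlinarith) (by nlinarith)) ?_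
  exact (intermediate_value_Icc hle ((continuousOn_f hp hp1).mono hab)).trans (image_mono hab)

/-- The linear growth bound makes the inverse Lipschitz with constant `c⁻¹` on the range, a
neighbourhood of `f p q`; this supplies the continuity required by the inverse derivative rule. -/
lemma hasDerivAt_fInv (hp : 0 < p) (hp1 : p < 1) (ext : ℝ → ℝ) {q : ℝ}
    (hq : q ∈ Ioo (-1 : ℝ) 1) : HasDerivAt (fInv p ext) (deriv (f p) q)⁻¹ (f p q) := by
  obtain ⟨c, hc, h⟩ := exists_mul_sub_le_f_sub hp hp1
  have hq' := fInv_f hp hp1 ext hq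
  have hnhds := image_f_mem_nhds hp hp1 hq
  refine HasDerivAt.of_local_left_inverse (f := f p) ?_ ?_ (deriv_f_pos hp hp1 hq).ne' ?_
  · rw [ContinuousAt, hq', tendsto_iff_norm_sub_tendsto_zero]
    have h0 : Tendsto (fun y => c⁻¹ * |y - f p q|) (𝓝 (f p q)) (𝓝 0) := by
      have : Continuous fun y => c⁻¹ * |y - f p q| := by fun_prop
      simpa using this.tendsto (f p q)
    refine squeeze_zero' (Eventually.of_forall fun y => norm_nonneg _) ?_ h0
    filter_upwards [hnhds] with y hy
    obtain ⟨hr, hy⟩ := fInv_of_mem (ext := ext) hy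
    set r := fInv p ext y
    rw [← hy, Real.norm_eq_abs, ← div_eq_inv_mul, le_div_iff₀ hc]
    have hrI := Ioo_subset_Icc_self hr
    have hqI := Ioo_subset_Icc_self hq
    rcases le_total r q with hl | hl
    · have h1 := h r hrI q hqI hl
      rw [abs_of_nonpos (by linarith), abs_of_nonpos (by nlinarith)]
      linarith
    · have h1 := h q hqI r hrI hl
      rw [abs_of_nonneg (by linarith), abs_of_nonneg (by nlinarith)]
      linarith
  · rw [hq']
    exact (differentiableAt_f hp hp1.le hq).hasDerivAt
  · filter_upwards [hnhds] with y hy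
    exact (fInv_of_mem hy).2

end Inverse

/-! ### Delta method -/

lemma measurable_dslope {h : ℝ → ℝ} (hh : Measurable h) (a : ℝ) : Measurable (dslope h a) := by
  classical
  have h1 : dslope h a = fun b => if b = a then deriv h a else (b - a)⁻¹ * (h b - h a) := by
    ext b
    by_cases hb : b = a
    · simp [hb]
    · rw [dslope_of_ne _ hb, slope_def_field, if_neg hb, div_eq_inv_mul]
  rw [h1]
  exact Measurable.ite (measurableSet_singleton a) measurable_const (by fun_prop)

/-- The delta method for sample means. -/
lemma tendstoInDistribution_delta {Ω : Type*} [MeasurableSpace Ω] {P : Measure Ω}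
    [IsProbabilityMeasure P] {Y : ℕ → Ω → ℝ} (hY : MemLp (Y 0) 2 P) (hindep : iIndepFun Y P)
    (hident : ∀ i, IdentDistrib (Y i) (Y 0) P P) {h : ℝ → ℝ} (hh : Measurable h) {L : ℝ}
    (hL : L ≠ 0) (hd : HasDerivAt h L (∫ ω, Y 0 ω ∂P)) {v : NNReal}
    (hv : (v : ℝ) = L ^ 2 * variance (Y 0) P) :
    TendstoInDistribution (fun (n : ℕ) ω => Real.sqrt n *
        (h ((n : ℝ)⁻¹ * ∑ t ∈ Finset.range n, Y t ω) - h (∫ ω, Y 0 ω ∂P)))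
      atTop (id : ℝ → ℝ) (fun _ => P) (gaussianReal 0 v) := by
  set m := ∫ ω, Y 0 ω ∂P
  have hYm : ∀ i, AEMeasurable (Y i) P := fun i => (hident i).aemeasurable_fst
  have hTm : ∀ n : ℕ, AEMeasurable (fun ω => (n : ℝ)⁻¹ * ∑ t ∈ Finset.range n, Y t ω) P :=
    fun n => (Finset.aemeasurable_fun_sum _ fun i _ => hYm i).const_mul _
  -- The limit in the central limit theorem is realized as `x / L` under the target law, so that
  -- multiplying by `L` leaves the identity.
  have hZ : HasLaw (fun x : ℝ => x / L) (gaussianReal 0 (variance (Y 0) P).toNNReal)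
      (gaussianReal 0 v) := by
    have h1 := gaussianReal_div_const (HasLaw.id (μ := gaussianReal 0 v)) L
    convert h1 using 2
    · simp only [id]
    · exact (zero_div L).symm
    · apply NNReal.coe_injective
      rw [NNReal.coe_div, hv, Real.coe_toNNReal _ (variance_nonneg _ _)]
      simp [hL]
  have hclt := tendstoInDistribution_inv_sqrt_mul_sum_sub hZ hY hindep hident
  have hlln := strong_law_ae_real Y (hY.integrable one_le_two)
    (fun i j hij => hindep.indepFun hij) hident
  have hslope : ∀ n : ℕ, AEMeasurable
      (fun ω => dslope h m ((n : ℝ)⁻¹ * ∑ t ∈ Finset.range n, Y t ω)) P :=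
    fun n => (measurable_dslope hh m).comp_aemeasurable (hTm n)
  have hprob : TendstoInMeasure P
      (fun (n : ℕ) ω => dslope h m ((n : ℝ)⁻¹ * ∑ t ∈ Finset.range n, Y t ω)) atTop
      (fun _ => L) := by
    refine tendstoInMeasure_of_tendsto_ae (fun n => (hslope n).aestronglyMeasurable) ?_
    filter_upwards [hlln] with ω hω
    have h1 := (continuousAt_dslope_same.2 hd.differentiableAt).tendsto
    rw [dslope_same, hd.deriv] at h1
    refine h1.comp (hω.congr fun n => ?_)
    rw [div_eq_inv_mul]
  -- Slutsky: the increment of `h` is exactly the increment of the mean times `dslope`, and `dslope`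
  -- tends to `L` by the strong law.
  have key := hclt.continuous_comp_prodMk_of_tendstoInMeasure_const
    (g := fun x : ℝ × ℝ => x.1 * x.2) (by fun_prop) hprob hslope
  refine TendstoInDistribution.congr (fun n => ae_of_all _ fun ω => ?_)
    (ae_of_all _ fun x => ?_) key
  · simp only
    have h1 := sub_smul_dslope h m ((n : ℝ)⁻¹ * ∑ t ∈ Finset.range n, Y t ω)
    rw [← h1, smul_eq_mul, ← mul_assoc]
    congr 1
    rcases Nat.eq_zero_or_pos n with rfl | hn
    · simp
    have hn0 : (0 : ℝ) < n := by exact_mod_cast hn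
    have hsq : Real.sqrt n * Real.sqrt n = n := Real.mul_self_sqrt hn0.le
    have hs0 : Real.sqrt n ≠ 0 := (Real.sqrt_pos.2 hn0).ne'
    rw [inv_mul_eq_iff_eq_mul₀ hs0, ← mul_assoc, hsq, mul_sub, mul_inv_cancel_left₀ hn0.ne']
  · simp [hL]

end StableLike

/-! ### Asymptotic normality of the estimator -/

theorem mainTheorem1
    {Ω₀ Ω : Type*} [MeasurableSpace Ω₀] [MeasurableSpace Ω]
    (P₀ : Measure Ω₀) [IsProbabilityMeasure P₀] (P : Measure Ω) [IsProbabilityMeasure P]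
    (α σ : Fin 2 → ℝ) (hα : ∀ i, α i ∈ Set.Ioo (1 : ℝ) 2) (hσ : ∀ i, 0 < σ i)
    (q : ℝ) (hq : q ∈ Set.Ioo (-1 : ℝ) 1)
    (p : ℝ) (hp : 0 < p) (hpα : ∀ i, p < α i / 4)
    (A : Fin 2 → Ω₀ → ℝ) (G : Ω₀ → EuclideanSpace ℝ (Fin 2))
    (hmodel : StableLike.IsModel P₀ α (StableLike.covMat σ q) A G)
    (X : ℕ → Ω → Fin 2 → ℝ) (hindep : iIndepFun X P)
    (hlaw : ∀ t, IdentDistrib (X t) (StableLike.modelVector A G) P P₀)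
    (ext : ℝ → ℝ) (hext : Measurable ext) :
    Set.InjOn (StableLike.f p) (Set.Ioo (-1) 1) ∧
    DifferentiableAt ℝ (StableLike.f p) q ∧
    deriv (StableLike.f p) q ≠ 0 ∧
    Integrable (fun ω => StableLike.g α σ p (StableLike.modelVector A G ω) ^ 2) P₀ ∧
    ∃ v : NNReal,
      (v : ℝ) = (deriv (StableLike.f p) q ^ 2)⁻¹ *
        ((∫ ω, StableLike.g α σ p (StableLike.modelVector A G ω) ^ 2 ∂P₀)
          - StableLike.f p q ^ 2) ∧
      TendstoInDistribution
        (fun (n : ℕ) ω => Real.sqrt n * (StableLike.qHat α σ p ext X n ω - q))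
        atTop (id : ℝ → ℝ) (fun _ => P) (gaussianReal 0 v) := by
  have hp1 : p < 1 := by linarith [hpα 0, (hα 0).2]
  have hderiv := (StableLike.deriv_f_pos hp hp1 hq).ne'
  have hg2 := hmodel.integrable_g_sq (σ := σ) hα hp hpα
  have hmean := hmodel.integral_g hα hσ (Set.Ioo_subset_Icc_self hq) hp hpα
  have hmem : MemLp (fun ω => StableLike.g α σ p (StableLike.modelVector A G ω)) 2 P₀ :=
    (memLp_two_iff_integrable_sq (hmodel.aestronglyMeasurable_modelVector hp)).2 hg2
  refine ⟨(StableLike.injOn_f hp hp1).mono Set.Ioo_subset_Icc_self,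
    StableLike.differentiableAt_f hp hp1.le hq, hderiv, hg2, ?_⟩
  have hgm : Measurable (StableLike.g α σ p) := (StableLike.continuous_g α σ hp).measurable
  have hid : ∀ t, IdentDistrib (fun ω => StableLike.g α σ p (X t ω))
      (fun ω => StableLike.g α σ p (StableLike.modelVector A G ω)) P P₀ :=
    fun t => (hlaw t).comp hgm
  have hEY : ∫ ω, StableLike.g α σ p (X 0 ω) ∂P = StableLike.f p q :=
    (hid 0).integral_eq.trans hmean
  have hvar : variance (fun ω => StableLike.g α σ p (X 0 ω)) P
      = (∫ ω, StableLike.g α σ p (StableLike.modelVector A G ω) ^ 2 ∂P₀)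
          - StableLike.f p q ^ 2 := by
    rw [(hid 0).variance_eq, variance_eq_sub hmem, hmean]
    rfl
  have hv0 : 0 ≤ (deriv (StableLike.f p) q ^ 2)⁻¹ *
        ((∫ ω, StableLike.g α σ p (StableLike.modelVector A G ω) ^ 2 ∂P₀)
          - StableLike.f p q ^ 2) := by
    -- The claimed variance is nonnegative because it is a square factor times the variance of `g (X
    -- 0)`.
    rw [← hvar]
    exact mul_nonneg (by positivity) (variance_nonneg _ _)
  refine ⟨⟨_, hv0⟩, rfl, ?_⟩
  have key := StableLike.tendstoInDistribution_delta
    (Y := fun t ω => StableLike.g α σ p (X t ω)) ((hid 0).memLp_iff.2 hmem)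
    (hindep.comp (fun _ => StableLike.g α σ p) fun _ => hgm)
    (fun t => (hid t).trans (hid 0).symm) (StableLike.measurable_fInv hp hp1 hext)
    (inv_ne_zero hderiv) (by rw [hEY]; exact StableLike.hasDerivAt_fInv hp hp1 ext hq)
    (v := ⟨_, hv0⟩) (by rw [hvar, inv_pow]; rfl)
  rw [hEY, StableLike.fInv_f hp hp1 ext hq] at key
  exact key
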